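/- Let $p$ be a prime number and let $k$ be an arbitrary field of characteristic $p$. Write $[a,b]=ab-ba$. Consider the following $k$-algebras, given by generators and relations: - $B2 = k\langle x,y,z\rangle/\langle [x,y]-y,\ [x,z],\ [y,z]-yf(x),\ x^p-x,\ y^p,\ z^p-z\rangle$, where $f(x)=\sum_{i=1}^{p-1}(-1)^{i-1}(p-i)^{-1}x^i$; - $C12 = k\langle x,y,z\rangle/\langle [x,y]-y,\ [x,z],\ [y,z],\ x^p-x,\ y^p-z,\ z^p\rangle$; - $C13 = k\langle x,y,z\rangle/\langle [x,y]-y,\ [x,z],\ [y,z],\ x^p-x,\ y^p,\ z^p-z\rangle$; - $C14 = k\langle x,y,z\rangle/\langle [x,y]-y,\ [x,z],\ [y,z],\ x^p-x,\ y^p-z,\ z^p-z\rangle$. For $n\ge 1$ let $\widetilde{\mathbb{A}}_n$ be the quiver with $n+1$ vertices and exactly one arrow starting in each vertex, forming an oriented cycle; let $k\widetilde{\mathbb{A}}_n$ be its path algebra and $J$ the two-sided ideal generated by the arrows. A finite-dimensional $k$-algebra $A$ is called symmetric if there is a nondegenerate symmetric $k$-bilinear form $\langle -,-\rangle\colon A\times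 A\to k$ with $\langle ab,c\rangle=\langle a,bc\rangle$ for all $a,b,c\in A$. Then, as $k$-algebras: (a) $B2\cong k\widetilde{\mathbb{A}}_{p^2-1}/J^p$, and this algebra is not symmetric. (b) $C12\cong k\widetilde{\mathbb{A}}_{p-1}/J^{p^2}$. (c) $C13$ is isomorphic to the direct sum of $p$ copies of $k\widetilde{\mathbb{A}}_{p-1}/J^p$, and the algebra $k\widetilde{\mathbb{A}}_{p-1}/J^p$ has dimension $p^2$ over $k$. (d) $C14\cong k\widetilde{\mathbb{A}}_{p-1}/J^p\oplus M_p(k)^{p-1}$, i.e. the direct sum of $k\widetilde{\mathbb{A}}_{p-1}/J^p$ and $p-1$ copies of the matrix algebra $M_p(k)$. -/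

import Mathlib

noncomputable section

universe u v w

namespace SelfinjNaka

/-! ### Path algebras of quivers with finitely many vertices -/

/-- All paths of a quiver, with their source and target (`⟨a, b, q⟩` is a path `q` from `a` to `b`;
trivial paths are included). -/
abbrev AnyPath (V : Type v) [Quiver.{w} V] : Type (max v w) :=
  Σ a b : V, Quiver.Path a b

/-- The underlying vector space of the path algebra `kQ`: the free module on all paths. -/
def PathAlgebra (k : Type u) [CommRing k] (V : Type v) [Quiver.{w} V] : Type (max u v w) :=
  AnyPath V →₀ k

namespace PathAlgebra

section

variable (k : Type u) [CommRing k] {V : Type v} [Quiver.{w} V]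

instance : AddCommGroup (PathAlgebra k V) := inferInstanceAs (AddCommGroup (AnyPath V →₀ k))

instance : Module k (PathAlgebra k V) := inferInstanceAs (Module k (AnyPath V →₀ k))

/-- A path, as an element of the path algebra. -/
def ofPath {a b : V} (q : Quiver.Path a b) : PathAlgebra k V :=
  Finsupp.single (⟨a, b, q⟩ : AnyPath V) (1 : k)

/-- The paths form a basis of the path algebra. -/
def basis : Module.Basis (AnyPath V) k (PathAlgebra k V) :=
  Module.Basis.ofRepr (LinearEquiv.refl k (AnyPath V →₀ k))

theorem basis_apply (q : AnyPath V) : basis k q = ofPath k q.2.2 := rfl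

open Classical in
/-- The product `q * r` of two paths: the path "first `r`, then `q`" if `r` ends where `q` starts,
and zero otherwise. -/
def pathMul (q r : AnyPath V) : PathAlgebra k V :=
  if h : r.2.1 = q.1 then ofPath k (r.2.2.comp (q.2.2.cast h.symm rfl)) else 0

/-- The bilinear extension of the product of paths. -/
def mulHom : PathAlgebra k V →ₗ[k] PathAlgebra k V →ₗ[k] PathAlgebra k V :=
  (basis k).constr k fun q => (basis k).constr k fun r => pathMul k q r

instance : Mul (PathAlgebra k V) := ⟨fun f g => mulHom k f g⟩

theorem mul_eq (f g : PathAlgebra k V) : f * g = mulHom k f g := rfl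

variable {k}

theorem ofPath_mul_ofPath {a b c : V} (q : Quiver.Path b c) (r : Quiver.Path a b) :
    ofPath k q * ofPath k r = ofPath k (r.comp q) := by
  have h : mulHom k (basis k ⟨b, c, q⟩) (basis k ⟨a, b, r⟩) = pathMul k ⟨b, c, q⟩ ⟨a, b, r⟩ := by
    simp only [mulHom, Module.Basis.constr_basis]
  rw [basis_apply, basis_apply] at h
  rw [mul_eq, h]
  simp [pathMul]

theorem ofPath_mul_ofPath_of_ne {a b c d : V} (q : Quiver.Path c d) (r : Quiver.Path a b)
    (hbc : b ≠ c) : ofPath k q * ofPath k r = 0 := by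
  have h : mulHom k (basis k ⟨c, d, q⟩) (basis k ⟨a, b, r⟩) = pathMul k ⟨c, d, q⟩ ⟨a, b, r⟩ := by
    simp only [mulHom, Module.Basis.constr_basis]
  rw [basis_apply, basis_apply] at h
  rw [mul_eq, h]
  simp [pathMul, hbc]

theorem zero_mul' (f : PathAlgebra k V) : 0 * f = 0 := by
  rw [mul_eq, map_zero, LinearMap.zero_apply]

theorem mul_zero' (f : PathAlgebra k V) : f * 0 = 0 := by
  rw [mul_eq, map_zero]

theorem ofPath_mul_assoc {a b c d e f : V} (q : Quiver.Path e f) (r : Quiver.Path c d)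
    (s : Quiver.Path a b) :
    ofPath k q * ofPath k r * ofPath k s = ofPath k q * (ofPath k r * ofPath k s) := by
  by_cases h1 : d = e
  · subst h1
    by_cases h2 : b = c
    · subst h2
      rw [ofPath_mul_ofPath, ofPath_mul_ofPath, ofPath_mul_ofPath, ofPath_mul_ofPath,
        Quiver.Path.comp_assoc]
    · rw [ofPath_mul_ofPath, ofPath_mul_ofPath_of_ne _ _ h2, ofPath_mul_ofPath_of_ne _ _ h2,
        mul_zero']
  · rw [ofPath_mul_ofPath_of_ne _ _ h1, zero_mul']
    by_cases h2 : b = c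
    · subst h2
      rw [ofPath_mul_ofPath, ofPath_mul_ofPath_of_ne _ _ h1]
    · rw [ofPath_mul_ofPath_of_ne _ _ h2, mul_zero']

/-- To prove an additive and homogeneous property it suffices to check it on paths. -/
theorem induction_on {P : PathAlgebra k V → Prop} (f : PathAlgebra k V) (h0 : P 0)
    (hadd : ∀ f g, P f → P g → P (f + g)) (hsmul : ∀ (c : k) f, P f → P (c • f))
    (hpath : ∀ {a b : V} (q : Quiver.Path a b), P (ofPath k q)) : P f := by
  have hf : f ∈ Submodule.span k (Set.range (basis k (V := V))) := by
    rw [(basis k).span_eq]; trivial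
  refine Submodule.span_induction (p := fun x _ => P x) ?_ h0 (fun x y _ _ => hadd x y)
    (fun c x _ => hsmul c x) hf
  rintro _ ⟨q, rfl⟩
  rw [basis_apply]
  exact hpath q.2.2

theorem add_mul' (f g h : PathAlgebra k V) : (f + g) * h = f * h + g * h := by
  simp only [mul_eq, map_add, LinearMap.add_apply]

theorem mul_add' (f g h : PathAlgebra k V) : f * (g + h) = f * g + f * h := by
  simp only [mul_eq, map_add]

theorem smul_mul' (c : k) (f g : PathAlgebra k V) : (c • f) * g = c • (f * g) := by
  simp only [mul_eq, map_smul, LinearMap.smul_apply]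

theorem mul_smul' (c : k) (f g : PathAlgebra k V) : f * (c • g) = c • (f * g) := by
  simp only [mul_eq, map_smul]

theorem mul_assoc' (f g h : PathAlgebra k V) : f * g * h = f * (g * h) := by
  refine induction_on (P := fun f => f * g * h = f * (g * h)) f (by simp only [zero_mul'])
    (fun f f' hf hf' => by simp only [add_mul', hf, hf'])
    (fun c f hf => by simp only [smul_mul', hf]) fun q => ?_
  refine induction_on (P := fun g => ofPath k q * g * h = ofPath k q * (g * h)) g (by simp only [zero_mul', mul_zero'])
    (fun g g' hg hg' => by simp only [add_mul', mul_add', hg, hg'])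
    (fun c g hg => by simp only [smul_mul', mul_smul', hg]) fun r => ?_
  refine induction_on
    (P := fun h => ofPath k q * ofPath k r * h = ofPath k q * (ofPath k r * h)) h (by simp only [mul_zero'])
    (fun h h' hh hh' => by simp only [mul_add', hh, hh'])
    (fun c h hh => by simp only [mul_smul', hh]) fun s => ?_
  exact ofPath_mul_assoc q r s

section Unital

variable [Fintype V]

/-- The unit of the path algebra: the sum of all trivial paths. -/
instance : One (PathAlgebra k V) := ⟨∑ a : V, ofPath k (Quiver.Path.nil : Quiver.Path a a)⟩

theorem one_eq : (1 : PathAlgebra k V) = ∑ a : V, ofPath k (Quiver.Path.nil : Quiver.Path a a) :=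
  rfl

theorem one_mul' (f : PathAlgebra k V) : 1 * f = f := by
  refine induction_on (P := fun f => 1 * f = f) f (mul_zero' _) (fun f g hf hg => by rw [mul_add', hf, hg])
    (fun c f hf => by rw [mul_smul', hf]) fun {a b} q => ?_
  rw [one_eq, mul_eq, map_sum, LinearMap.sum_apply, Finset.sum_eq_single b]
  · rw [← mul_eq, ofPath_mul_ofPath, Quiver.Path.comp_nil]
  · intro c _ hc
    rw [← mul_eq, ofPath_mul_ofPath_of_ne _ _ hc.symm]
  · simp

theorem mul_one' (f : PathAlgebra k V) : f * 1 = f := by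
  refine induction_on (P := fun f => f * 1 = f) f (zero_mul' _) (fun f g hf hg => by rw [add_mul', hf, hg])
    (fun c f hf => by rw [smul_mul', hf]) fun {a b} q => ?_
  rw [one_eq, mul_eq, map_sum, Finset.sum_eq_single a]
  · rw [← mul_eq, ofPath_mul_ofPath, Quiver.Path.nil_comp]
  · intro c _ hc
    rw [← mul_eq, ofPath_mul_ofPath_of_ne _ _ hc]
  · simp

instance : Ring (PathAlgebra k V) where
  __ := (inferInstance : AddCommGroup (PathAlgebra k V))
  mul := (· * ·)
  one := 1
  zero_mul := zero_mul'
  mul_zero := mul_zero'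
  left_distrib := mul_add'
  right_distrib := add_mul'
  mul_assoc := mul_assoc'
  one_mul := one_mul'
  mul_one := mul_one'

instance : Algebra k (PathAlgebra k V) := Algebra.ofModule smul_mul' fun c f g => mul_smul' c f g

variable (k V) in
/-- The arrow ideal of the path algebra: the two-sided ideal generated by all arrows. -/
def arrowIdeal : Ideal (PathAlgebra k V) :=
  (TwoSidedIdeal.span {f : PathAlgebra k V |
    ∃ (a b : V) (e : a ⟶ b), f = ofPath k e.toPath}).asIdeal

instance : (arrowIdeal k V).IsTwoSided :=
  inferInstanceAs (TwoSidedIdeal.asIdeal _).IsTwoSided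

end Unital

end

end PathAlgebra

/-! ### The cyclic quiver and the truncated path algebras `kÃ_n / J^t` -/

/-- The vertices of the quiver `Ã_n`: there are `n + 1` of them, cyclically ordered. -/
def CyclicQuiver (n : ℕ) : Type := ZMod (n + 1)

instance (n : ℕ) : Fintype (CyclicQuiver n) := inferInstanceAs (Fintype (ZMod (n + 1)))

/-- The quiver `Ã_n`: exactly one arrow `i ⟶ i + 1` for each vertex `i`, and no other arrows. -/
instance (n : ℕ) : Quiver.{0} (CyclicQuiver n) where
  Hom i j := {_e : Unit // (show ZMod (n + 1) from j) = (show ZMod (n + 1) from i) + 1}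

/-- The algebra `kÃ_n / J^t`, with `J` the ideal of `kÃ_n` generated by the arrows. -/
abbrev CyclicTruncated (k : Type u) [Field k] (n t : ℕ) : Type u :=
  PathAlgebra k (CyclicQuiver n) ⧸ (PathAlgebra.arrowIdeal k (CyclicQuiver n)) ^ t

/-! ### Symmetric algebras -/

/-- A (finite-dimensional) algebra is symmetric if it has a nondegenerate symmetric associative
bilinear form. -/
def IsSymmetricAlgebra (k : Type u) [Field k] (A : Type v) [Ring A] [Algebra k A] : Prop :=
  ∃ B : LinearMap.BilinForm k A, B.Nondegenerate ∧ (∀ a b : A, B a b = B b a) ∧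
    ∀ a b c : A, B (a * b) c = B a (b * c)

/-! ### The algebras `k⟨x, y, z⟩ / I` -/

section Types

variable (k : Type u) [Field k]

/-- The generator `x` of the free algebra `k⟨x, y, z⟩`. -/
abbrev genX : FreeAlgebra k (Fin 3) := FreeAlgebra.ι k 0

/-- The generator `y` of the free algebra `k⟨x, y, z⟩`. -/
abbrev genY : FreeAlgebra k (Fin 3) := FreeAlgebra.ι k 1

/-- The generator `z` of the free algebra `k⟨x, y, z⟩`. -/
abbrev genZ : FreeAlgebra k (Fin 3) := FreeAlgebra.ι k 2

/-- The element `f(x) = ∑_{i=1}^{p-1} (-1)^{i-1} (p-i)^{-1} x^i`. -/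
def polyF (p : ℕ) : FreeAlgebra k (Fin 3) :=
  ∑ i ∈ Finset.Icc 1 (p - 1), ((-1 : k) ^ (i - 1) * (((p : k) - (i : k)))⁻¹) • genX k ^ i

/-- The defining relations of the algebra of type **B2**. -/
inductive RelB2 (p : ℕ) : FreeAlgebra k (Fin 3) → FreeAlgebra k (Fin 3) → Prop
  | xy : RelB2 p (genX k * genY k - genY k * genX k) (genY k)
  | xz : RelB2 p (genX k * genZ k - genZ k * genX k) 0
  | yz : RelB2 p (genY k * genZ k - genZ k * genY k) (genY k * polyF k p)
  | xp : RelB2 p (genX k ^ p) (genX k)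
  | yp : RelB2 p (genY k ^ p) 0
  | zp : RelB2 p (genZ k ^ p) (genZ k)

/-- The defining relations of the algebra of type **C12**. -/
inductive RelC12 (p : ℕ) : FreeAlgebra k (Fin 3) → FreeAlgebra k (Fin 3) → Prop
  | xy : RelC12 p (genX k * genY k - genY k * genX k) (genY k)
  | xz : RelC12 p (genX k * genZ k - genZ k * genX k) 0
  | yz : RelC12 p (genY k * genZ k - genZ k * genY k) 0
  | xp : RelC12 p (genX k ^ p) (genX k)
  | yp : RelC12 p (genY k ^ p) (genZ k)
  | zp : RelC12 p (genZ k ^ p) 0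

/-- The defining relations of the algebra of type **C13**. -/
inductive RelC13 (p : ℕ) : FreeAlgebra k (Fin 3) → FreeAlgebra k (Fin 3) → Prop
  | xy : RelC13 p (genX k * genY k - genY k * genX k) (genY k)
  | xz : RelC13 p (genX k * genZ k - genZ k * genX k) 0
  | yz : RelC13 p (genY k * genZ k - genZ k * genY k) 0
  | xp : RelC13 p (genX k ^ p) (genX k)
  | yp : RelC13 p (genY k ^ p) 0
  | zp : RelC13 p (genZ k ^ p) (genZ k)

/-- The defining relations of the algebra of type **C14**. -/
inductive RelC14 (p : ℕ) : FreeAlgebra k (Fin 3) → FreeAlgebra k (Fin 3) → Prop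
  | xy : RelC14 p (genX k * genY k - genY k * genX k) (genY k)
  | xz : RelC14 p (genX k * genZ k - genZ k * genX k) 0
  | yz : RelC14 p (genY k * genZ k - genZ k * genY k) 0
  | xp : RelC14 p (genX k ^ p) (genX k)
  | yp : RelC14 p (genY k ^ p) (genZ k)
  | zp : RelC14 p (genZ k ^ p) (genZ k)

/-- The algebra of type **B2**. -/
abbrev AlgB2 (p : ℕ) : Type u := RingQuot (RelB2 k p)

/-- The algebra of type **C12**. -/
abbrev AlgC12 (p : ℕ) : Type u := RingQuot (RelC12 k p)

/-- The algebra of type **C13**. -/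
abbrev AlgC13 (p : ℕ) : Type u := RingQuot (RelC13 k p)

/-- The algebra of type **C14**. -/
abbrev AlgC14 (p : ℕ) : Type u := RingQuot (RelC14 k p)

end Types

end SelfinjNaka

end

/-! The relation x^p = x makes x diagonalizable with eigenvalues in the prime field: interpolation
at the points of F_p (`deltaPoly`) yields a complete family of orthogonal idempotents
(`completeOrthogonalIdempotents_eigenIdem`), and [x, y] = y says that y raises the eigenvalue of x
by one (`mul_eigenIdem_of_commutator`). On the other side, kÃ_n/J^t is universal (`cyclicLift`) for
complete orthogonal idempotents e_i, i in Z/(n+1), together with an element y, the sum of all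
arrows, such that y e_i = e_{i+1} y and y^t = 0. The isomorphisms for B2 and C12 play these two
presentations against each other and check composites on generators, so no dimension of an algebra
given by relations is needed.

In C12 the generator z = y^p is redundant. In C13 and C14 the element z is central with z^p = z, so
its spectral idempotents cut the algebra into blocks z = b. In C13 every block is the cyclic
algebra. In C14 the block b = 0 is cyclic, while for b ≠ 0 the relation y^p = b makes y a multiple
of a cyclic permutation, and the block is M_p(k) (`matrixLift`).

In B2 the vertices are the joint eigenvalues (a, b) of x and z, and y moves (a, b) to (a + 1, b -
f(a)). The values of f on F_p sum to 1 (`sum_shiftVal`), so p steps lower b by one and all p^2 pairs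
form a single cycle (`bijective_shiftOrbit`). The algebra is not symmetric because a longest nonzero
path has length p - 1, which is not a multiple of p^2: such a path is not closed, and it pairs to
zero with everything. -/

noncomputable section

namespace SelfinjNaka

open Polynomial

/-! ### Complete orthogonal idempotents and diagonal elements. -/

section Idempotents

variable {k A I : Type*} [Field k] [Ring A] [Algebra k A] [Fintype I]

/-- A complete family of orthogonal idempotents gives a homomorphism from the algebra of functions
on the index set. -/
def diagHom (k : Type*) [Field k] [Algebra k A] {e : I → A}
    (he : CompleteOrthogonalIdempotents e) : (I → k) →ₐ[k] A :=
  AlgHom.ofLinearMap (Fintype.linearCombination k e)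
    (by simp [Fintype.linearCombination_apply, he.complete])
    (fun f g => by
      classical
      simp only [Fintype.linearCombination_apply, Finset.sum_mul_sum, smul_mul_smul_comm,
        he.mul_eq, Pi.mul_apply, smul_ite, smul_zero, Finset.sum_ite_eq, Finset.mem_univ, if_true])

theorem diagHom_apply {e : I → A} (he : CompleteOrthogonalIdempotents e) (g : I → k) :
    diagHom k he g = ∑ i, g i • e i := rfl

theorem diagHom_single [DecidableEq I] {e : I → A} (he : CompleteOrthogonalIdempotents e) (i : I) :
    diagHom k he (Pi.single i 1) = e i := by
  simp [diagHom_apply, Pi.single_apply]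

/-- Moving y across a diagonal element only relabels eigenvalues; every commutator relation in a
cyclic algebra is verified through this. -/
theorem diagHom_mul_of_shift {e : I → A} (he : CompleteOrthogonalIdempotents e) (τ : I ≃ I)
    {y : A} (hy : ∀ i, y * e i = e (τ i) * y) (g : I → k) :
    diagHom k he g * y = y * diagHom k he (g ∘ τ) := by
  simp only [diagHom_apply, Finset.sum_mul, Finset.mul_sum, smul_mul_assoc, mul_smul_comm, hy,
    Function.comp_apply]
  exact (τ.sum_comp fun i => g i • (e i * y)).symm

theorem completeOrthogonalIdempotents_mul {I' : Type*} [Fintype I'] {e : I → A} {c : I' → A}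
    (he : CompleteOrthogonalIdempotents e) (hc : CompleteOrthogonalIdempotents c)
    (h : ∀ i j, Commute (c j) (e i)) :
    CompleteOrthogonalIdempotents (fun s : I × I' => c s.2 * e s.1) where
  idem s := by
    change c s.2 * e s.1 * (c s.2 * e s.1) = c s.2 * e s.1
    rw [mul_assoc, ← mul_assoc (e s.1), ← (h s.1 s.2).eq, mul_assoc, (he.idem s.1).eq, ← mul_assoc,
      (hc.idem s.2).eq]
  ortho s t hst := by
    change c s.2 * e s.1 * (c t.2 * e t.1) = 0
    rw [mul_assoc, ← mul_assoc (e s.1), ← (h s.1 t.2).eq, mul_assoc (c t.2), ← mul_assoc]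
    by_cases h1 : s.1 = t.1
    · have h2 : s.2 ≠ t.2 := fun h2 => hst (Prod.ext h1 h2)
      rw [hc.ortho h2, zero_mul]
    · rw [he.ortho h1, mul_zero]
  complete := by
    rw [Fintype.sum_prod_type_right]
    simp only [← Finset.mul_sum, he.complete, mul_one, hc.complete]

theorem mul_aeval_of_semiconj {y x x' : A} (h : y * x = x' * y) (q : k[X]) :
    y * aeval x q = aeval x' q * y := by
  induction q using Polynomial.induction_on' with
  | add q r hq hr => simp [mul_add, add_mul, hq, hr]
  | monomial n c =>
    have h1 : SemiconjBy y (x ^ n) (x' ^ n) := SemiconjBy.pow_right h n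
    rw [aeval_monomial, aeval_monomial, mul_assoc, ← h1.eq, ← mul_assoc, ← mul_assoc,
      Algebra.commutes]

end Idempotents

/-! ### Spectral idempotents of an element with x^p = x. -/

section PrimeField

variable (p : ℕ) [Fact p.Prime] (k : Type*) [Field k] [CharP k p]

/-- The inclusion of the prime field. -/
def primeHom : ZMod p →+* k := ZMod.castHom (dvd_refl p) k

variable {k} in
theorem primeHom_pow (a : ZMod p) : primeHom p k a ^ p = primeHom p k a := by
  rw [← map_pow, ZMod.pow_card]

/-- The polynomial that is `1` at `a` and vanishes at all other elements of the prime field. -/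
def deltaPoly (a : ZMod p) : k[X] := 1 - (X - C (primeHom p k a)) ^ (p - 1)

theorem eval_deltaPoly (a b : ZMod p) :
    (deltaPoly p k a).eval (primeHom p k b) = if b = a then 1 else 0 := by
  have hp : p - 1 ≠ 0 := Nat.sub_ne_zero_of_lt (Fact.out : p.Prime).one_lt
  simp only [deltaPoly, eval_sub, eval_one, eval_pow, eval_X, eval_C, ← map_sub, ← map_pow]
  split_ifs with h
  · simp [h, hp]
  · rw [ZMod.pow_card_sub_one_eq_one (sub_ne_zero.2 h), map_one, sub_self]

/-- Frobenius gives (X - a)^p = X^p - a, since a lies in the prime field. -/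
theorem X_sub_C_mul_deltaPoly (a : ZMod p) :
    (X - C (primeHom p k a)) * deltaPoly p k a = X - X ^ p := by
  have h : (X - C (primeHom p k a)) ^ p = X ^ p - C (primeHom p k a) := by
    rw [sub_pow_char, ← C_pow, primeHom_pow]
  rw [deltaPoly, mul_sub, mul_one, mul_pow_sub_one (Fact.out : p.Prime).ne_zero, h]
  ring

/-- The difference of the two sides has degree at most p - 1 and vanishes at the p points of the
prime field. -/
theorem sum_deltaPoly : ∑ a, deltaPoly p k a = 1 := by
  rw [← sub_eq_zero]
  refine eq_zero_of_natDegree_lt_card_of_eval_eq_zero _ (primeHom p k).injective (fun b => ?_) ?_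
  · simp [eval_finsetSum, eval_deltaPoly]
  · have hp := (Fact.out : p.Prime).pos
    rw [ZMod.card]
    refine lt_of_le_of_lt (b := p - 1) ?_ (by omega)
    refine (natDegree_sub_le_of_le (natDegree_sum_le_of_forall_le _ _ fun a _ => ?_)
      (by simp)).trans (by simp : max (p - 1) 0 ≤ p - 1)
    refine (natDegree_sub_le_of_le (m := 0) (n := p - 1) (by simp) ?_).trans (by simp)
    exact (natDegree_pow_le_of_le _ (natDegree_X_sub_C_le _)).trans (by simp)

variable {A : Type*} [Ring A] [Algebra k A]

/-- The projection to the eigenspace with eigenvalue `a` of an element with `x ^ p = x`. -/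
def eigenIdem (x : A) (a : ZMod p) : A := aeval x (deltaPoly p k a)

variable {k}

/-- X - a divides q - q(a), so (q - q(a)) times the interpolation polynomial at a is a multiple of X
- X^p, which annihilates x. -/
theorem aeval_mul_eigenIdem {x : A} (hx : x ^ p = x) (a : ZMod p) (q : k[X]) :
    aeval x q * eigenIdem p k x a = q.eval (primeHom p k a) • eigenIdem p k x a := by
  obtain ⟨r, hr⟩ := X_sub_C_dvd_sub_C_eval (a := primeHom p k a) (p := q)
  have h : (q - C (q.eval (primeHom p k a))) * deltaPoly p k a = r * (X - X ^ p) := by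
    rw [hr, ← X_sub_C_mul_deltaPoly p k a]; ring
  have h2 := congrArg (aeval x) h
  simp only [map_mul, map_sub, aeval_C, aeval_X, map_pow, hx, sub_self, mul_zero, sub_mul,
    sub_eq_zero] at h2
  rw [eigenIdem, h2, Algebra.smul_def]

theorem mul_eigenIdem {x : A} (hx : x ^ p = x) (a : ZMod p) :
    x * eigenIdem p k x a = primeHom p k a • eigenIdem p k x a := by
  simpa using aeval_mul_eigenIdem p hx a (X : k[X])

theorem eigenIdem_mul_eigenIdem {x : A} (hx : x ^ p = x) (a b : ZMod p) :
    eigenIdem p k x b * eigenIdem p k x a = if a = b then eigenIdem p k x a else 0 := by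
  rw [eigenIdem, aeval_mul_eigenIdem p hx, eval_deltaPoly]
  split_ifs <;> simp

theorem completeOrthogonalIdempotents_eigenIdem {x : A} (hx : x ^ p = x) :
    CompleteOrthogonalIdempotents (eigenIdem p k x) where
  idem a := by
    change _ * _ = _
    simp [eigenIdem_mul_eigenIdem p hx]
  ortho a b hab := by
    change _ * _ = _
    simp [eigenIdem_mul_eigenIdem p hx, hab.symm]
  complete := by
    simp only [eigenIdem, ← map_sum, sum_deltaPoly, map_one]

theorem sum_smul_eigenIdem {x : A} (hx : x ^ p = x) :
    ∑ a, primeHom p k a • eigenIdem p k x a = x := by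
  simp only [← mul_eigenIdem p hx, ← Finset.mul_sum,
    (completeOrthogonalIdempotents_eigenIdem (k := k) p hx).complete, mul_one]

theorem map_eigenIdem {B : Type*} [Ring B] [Algebra k B] (φ : A →ₐ[k] B) (x : A) (a : ZMod p) :
    φ (eigenIdem p k x a) = eigenIdem p k (φ x) a := by
  rw [eigenIdem, eigenIdem, aeval_algHom_apply]

theorem eigenIdem_sub (x : A) (a c : ZMod p) :
    eigenIdem p k (x - algebraMap k A (primeHom p k c)) a = eigenIdem p k x (a + c) := by
  simp [eigenIdem, deltaPoly, sub_sub, add_comm]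

theorem eigenIdem_algebraMap (a b : ZMod p) :
    eigenIdem p k (algebraMap k A (primeHom p k b)) a = if b = a then 1 else 0 := by
  rw [eigenIdem, aeval_algebraMap_apply, coe_aeval_eq_eval, eval_deltaPoly]
  split_ifs <;> simp

theorem eigenIdem_pi {I : Type*} (g : I → ZMod p) (a : ZMod p) :
    eigenIdem p k (fun i => primeHom p k (g i)) a = fun i => if g i = a then 1 else 0 := by
  funext i
  rw [← eval_deltaPoly p k a (g i)]
  have h := map_eigenIdem p (Pi.evalAlgHom k (fun _ : I => k) i) (fun i => primeHom p k (g i)) a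
  exact h

theorem commute_eigenIdem {x y : A} (h : Commute y x) (a : ZMod p) :
    Commute y (eigenIdem p k x a) :=
  mul_aeval_of_semiconj h _

/-- The hypothesis reads y x = (x - 1) y, so y carries a polynomial in x to the same polynomial in x
- 1, and translating x translates the eigenvalue. -/
theorem mul_eigenIdem_of_commutator {x y : A} (h : x * y - y * x = y) (a : ZMod p) :
    y * eigenIdem p k x a = eigenIdem p k x (a + 1) * y := by
  have h1 : y * x = (x - algebraMap k A (primeHom p k 1)) * y := by
    rw [map_one, map_one, sub_mul, one_mul, ← h]
    simp only [h]
    rw [eq_sub_iff_add_eq, ← eq_sub_iff_add_eq', h]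
  rw [eigenIdem, mul_aeval_of_semiconj h1, ← eigenIdem, eigenIdem_sub]

end PrimeField

open PathAlgebra

/-! ### Powers of the arrow ideal and path length. -/

section LongPaths

variable {k V : Type*} [Field k] [Quiver V] [Fintype V]

/-- The span of all paths of length at least `m`. -/
def longPaths (k V : Type*) [Field k] [Quiver V] [Fintype V] (m : ℕ) :
    Submodule k (PathAlgebra k V) :=
  Submodule.span k {f | ∃ (a b : V) (q : Quiver.Path a b), m ≤ q.length ∧ f = ofPath k q}

theorem ofPath_mem_longPaths {m : ℕ} {a b : V} (q : Quiver.Path a b) (h : m ≤ q.length) :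
    ofPath k q ∈ longPaths k V m :=
  Submodule.subset_span ⟨a, b, q, h, rfl⟩

theorem mul_mem_longPaths {m n : ℕ} {f g : PathAlgebra k V} (hf : f ∈ longPaths k V m)
    (hg : g ∈ longPaths k V n) : f * g ∈ longPaths k V (m + n) := by
  have h : longPaths k V m * longPaths k V n ≤ longPaths k V (m + n) := by
    rw [longPaths, longPaths, Submodule.span_mul_span, Submodule.span_le]
    rintro _ ⟨_, ⟨a, b, q, hq, rfl⟩, _, ⟨c, d, r, hr, rfl⟩, rfl⟩
    by_cases hda : d = a
    · subst hda
      change ofPath k q * ofPath k r ∈ _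
      rw [ofPath_mul_ofPath]
      exact ofPath_mem_longPaths _ (by rw [Quiver.Path.length_comp]; omega)
    · change ofPath k q * ofPath k r ∈ _
      rw [ofPath_mul_ofPath_of_ne _ _ hda]
      exact zero_mem _
  exact h (Submodule.mul_mem_mul hf hg)

theorem mem_longPaths_zero (f : PathAlgebra k V) : f ∈ longPaths k V 0 :=
  PathAlgebra.induction_on f (zero_mem _) (fun _ _ => add_mem)
    (fun c _ => Submodule.smul_mem _ c) fun q => ofPath_mem_longPaths q (Nat.zero_le _)

theorem mul_mem_longPaths_left {m : ℕ} (f : PathAlgebra k V) {g : PathAlgebra k V}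
    (hg : g ∈ longPaths k V m) : f * g ∈ longPaths k V m := by
  simpa using mul_mem_longPaths (mem_longPaths_zero f) hg

theorem mul_mem_longPaths_right {m : ℕ} {f : PathAlgebra k V} (g : PathAlgebra k V)
    (hf : f ∈ longPaths k V m) : f * g ∈ longPaths k V m := by
  simpa using mul_mem_longPaths hf (mem_longPaths_zero g)

theorem mem_longPaths_of_mem_arrowIdeal {f : PathAlgebra k V} (hf : f ∈ arrowIdeal k V) :
    f ∈ longPaths k V 1 := by
  have h := TwoSidedIdeal.mem_span_iff.1 (TwoSidedIdeal.mem_asIdeal.1 hf)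
    (TwoSidedIdeal.mk' (longPaths k V 1) (zero_mem _) add_mem neg_mem
      (fun hg => mul_mem_longPaths_left _ hg) (fun hg => mul_mem_longPaths_right _ hg)) (by
      rintro _ ⟨a, b, e, rfl⟩
      rw [SetLike.mem_coe, TwoSidedIdeal.mem_mk']
      exact ofPath_mem_longPaths _ (le_of_eq rfl))
  rwa [TwoSidedIdeal.mem_mk'] at h

/-- Lengths add under multiplication of paths. Thanks to this inclusion, a linear map factors
through the truncated algebra as soon as it kills the long paths. -/
theorem mem_longPaths_of_mem_arrowIdeal_pow {m : ℕ} {f : PathAlgebra k V}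
    (hf : f ∈ arrowIdeal k V ^ m) : f ∈ longPaths k V m := by
  induction m generalizing f with
  | zero => exact mem_longPaths_zero f
  | succ m ih =>
    -- A product of ideals is compared with an ideal, so the span of the long paths is first
    -- promoted to a left ideal.
    have h : arrowIdeal k V ^ m * arrowIdeal k V ≤
        { longPaths k V (m + 1) with
          smul_mem' := fun c _ hg => mul_mem_longPaths_left c hg } :=
      Ideal.mul_le.2 fun r hr s hs =>
        mul_mem_longPaths (ih hr) (mem_longPaths_of_mem_arrowIdeal hs)
    rw [Submodule.pow_succ] at hf
    exact h hf

theorem ofPath_mem_arrowIdeal_pow {a b : V} (q : Quiver.Path a b) :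
    ofPath k q ∈ arrowIdeal k V ^ q.length := by
  induction q with
  | nil => rw [Quiver.Path.length_nil, Submodule.pow_zero, Ideal.one_eq_top]; trivial
  | cons q e ih =>
    have h : ofPath k (q.cons e) = ofPath k e.toPath * ofPath k q := by
      rw [ofPath_mul_ofPath]; rfl
    rw [h, Quiver.Path.length_cons, add_comm, Ideal.IsTwoSided.pow_add, Submodule.pow_one]
    exact Ideal.mul_mem_mul
      (TwoSidedIdeal.mem_asIdeal.2 (TwoSidedIdeal.subset_span ⟨_, _, e, rfl⟩)) ih

end LongPaths

theorem pow_mul_of_shift {A R : Type*} [Ring A] [AddMonoidWithOne R] {e : R → A} {y : A}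
    (hy : ∀ i, y * e i = e (i + 1) * y) (m : ℕ) (i : R) :
    y ^ m * e i = e (i + m) * y ^ m := by
  induction m with
  | zero => simp
  | succ m ih =>
    rw [pow_succ', mul_assoc, ih, ← mul_assoc, hy, mul_assoc, Nat.cast_succ, add_assoc]

/-! ### Paths in the cyclic quiver. -/

section Cyclic

variable {n : ℕ}

/-- An element of `ZMod (n + 1)`, as a vertex of the cyclic quiver. -/
abbrev cyclicVertex (i : ZMod (n + 1)) : CyclicQuiver n := i

/-- A vertex of the cyclic quiver, as an element of `ZMod (n + 1)`. -/
abbrev cyclicIndex (a : CyclicQuiver n) : ZMod (n + 1) := a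

/-- The arrow starting in a vertex of the cyclic quiver. -/
def cyclicArrow (i : ZMod (n + 1)) : cyclicVertex i ⟶ cyclicVertex (i + 1) := ⟨(), rfl⟩

theorem length_path_cyclicQuiver {a b : CyclicQuiver n} (q : Quiver.Path a b) :
    cyclicIndex b = cyclicIndex a + (q.length : ZMod (n + 1)) := by
  induction q with
  | nil => rw [Quiver.Path.length_nil, Nat.cast_zero, add_zero]
  | cons q e ih =>
    rw [Quiver.Path.length_cons, Nat.cast_add, Nat.cast_one, ← add_assoc, ← ih]
    exact e.2

end Cyclic

/-! ### Generators, universal property, basis and forms of the truncated cyclic algebra. -/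

section Truncated

variable (k : Type*) [Field k] (n t : ℕ)

/-- The class of the trivial path at a vertex. -/
def vertexIdem (i : ZMod (n + 1)) : CyclicTruncated k n t :=
  Ideal.Quotient.mk _ (ofPath k (Quiver.Path.nil : Quiver.Path (cyclicVertex i) (cyclicVertex i)))

/-- The class of the sum of all arrows. -/
def arrowSum : CyclicTruncated k n t :=
  Ideal.Quotient.mk _ (∑ i : ZMod (n + 1), ofPath k (cyclicArrow i).toPath)

theorem completeOrthogonalIdempotents_vertexIdem :
    CompleteOrthogonalIdempotents (vertexIdem k n t) where
  idem i := by
    change _ * _ = _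
    rw [vertexIdem, ← map_mul, ofPath_mul_ofPath]; rfl
  ortho i j hij := by
    change _ * _ = _
    rw [vertexIdem, vertexIdem, ← map_mul,
      ofPath_mul_ofPath_of_ne (V := CyclicQuiver n) _ _ hij.symm,
      map_zero]
  complete := by
    simp only [vertexIdem]
    rw [← map_sum, ← map_one (Ideal.Quotient.mk _), PathAlgebra.one_eq]
    rfl

theorem arrowSum_mul_mk {a : CyclicQuiver n} {i : ZMod (n + 1)}
    (q : Quiver.Path a (cyclicVertex i)) :
    arrowSum k n t * Ideal.Quotient.mk _ (ofPath k q) =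
      Ideal.Quotient.mk _ (ofPath k (q.cons (cyclicArrow i))) := by
  rw [arrowSum, ← map_mul, Finset.sum_mul, Finset.sum_eq_single i, ofPath_mul_ofPath]
  · rfl
  · intro j _ hj
    exact ofPath_mul_ofPath_of_ne _ _ hj.symm
  · simp

theorem arrowSum_mul_vertexIdem (i : ZMod (n + 1)) :
    arrowSum k n t * vertexIdem k n t i = vertexIdem k n t (i + 1) * arrowSum k n t := by
  rw [vertexIdem, arrowSum_mul_mk, arrowSum, vertexIdem, ← map_mul, Finset.mul_sum,
    Finset.sum_eq_single i, ofPath_mul_ofPath]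
  · rfl
  · intro j _ hj
    exact ofPath_mul_ofPath_of_ne _ _ fun h => hj (add_right_cancel h)
  · simp

/-- Exactly one arrow leaves each vertex, so multiplying by the sum of all arrows prolongs a path in
the only possible way. Hence the vertices and this one element generate the algebra. -/
theorem mk_ofPath {a b : CyclicQuiver n} (q : Quiver.Path a b) :
    (Ideal.Quotient.mk _ (ofPath k q) : CyclicTruncated k n t) =
      arrowSum k n t ^ q.length * vertexIdem k n t (cyclicIndex a) := by
  induction q with
  | nil => rw [Quiver.Path.length_nil, pow_zero, one_mul]; rfl
  | @cons b c q e ih =>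
    obtain ⟨⟨⟩, he⟩ := e
    change c = cyclicVertex (cyclicIndex b + 1) at he
    subst he
    change _ = arrowSum k n t ^ (q.length + 1) * _
    rw [pow_succ', mul_assoc, ← ih]
    exact (arrowSum_mul_mk k n t (i := b) q).symm

/-- A path of given length in the cyclic quiver. -/
def cyclicPath (i : ZMod (n + 1)) : (m : ℕ) → Quiver.Path (cyclicVertex i) (cyclicVertex (i + m))
  | 0 => Quiver.Path.nil.cast rfl (by simp)
  | m + 1 => (cyclicPath i m).cons ⟨(), by
      change i + ((m + 1 : ℕ) : ZMod (n + 1)) = i + m + 1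
      push_cast; ring⟩

theorem length_cyclicPath (i : ZMod (n + 1)) (m : ℕ) : (cyclicPath n i m).length = m := by
  induction m with
  | zero =>
    have h {a b : CyclicQuiver n} (hab : a = b) :
        ((Quiver.Path.nil : Quiver.Path a a).cast rfl hab).length = 0 := by subst hab; rfl
    exact h _
  | succ m ih => rw [cyclicPath, Quiver.Path.length_cons, ih]

theorem mk_cyclicPath (i : ZMod (n + 1)) (m : ℕ) :
    (Ideal.Quotient.mk _ (ofPath k (cyclicPath n i m)) : CyclicTruncated k n t) =
      arrowSum k n t ^ m * vertexIdem k n t i := by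
  rw [mk_ofPath, length_cyclicPath]

theorem arrowSum_pow : arrowSum k n t ^ t = 0 := by
  rw [← mul_one (arrowSum k n t ^ t), ← (completeOrthogonalIdempotents_vertexIdem k n t).complete,
    Finset.mul_sum]
  refine Finset.sum_eq_zero fun i _ => ?_
  rw [← mk_cyclicPath, Ideal.Quotient.eq_zero_iff_mem]
  have h := ofPath_mem_arrowIdeal_pow (k := k) (cyclicPath n i t)
  rwa [length_cyclicPath] at h

variable {k n t}

theorem cyclicTruncated_induction {P : CyclicTruncated k n t → Prop} (f : CyclicTruncated k n t)
    (h0 : P 0) (hadd : ∀ f g, P f → P g → P (f + g)) (hsmul : ∀ (c : k) f, P f → P (c • f))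
    (hpath : ∀ m i, P (arrowSum k n t ^ m * vertexIdem k n t i)) : P f := by
  obtain ⟨f, rfl⟩ := Ideal.Quotient.mk_surjective f
  refine PathAlgebra.induction_on (P := fun f => P (Ideal.Quotient.mk _ f)) f (by simpa using h0)
    (fun f g hf hg => by rw [map_add]; exact hadd _ _ hf hg) (fun c f hf => ?_) fun q => ?_
  · exact hsmul c _ hf
  · rw [mk_ofPath]
    exact hpath _ _

section Lift

variable {A : Type*} [Ring A] [Algebra k A] {e : ZMod (n + 1) → A} {y : A}

/-- The linear map on the path algebra of the cyclic quiver determined by the images of the vertices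
and of the sum of the arrows. -/
def cyclicLiftLinear (k : Type*) [Field k] [Algebra k A] (e : ZMod (n + 1) → A) (y : A) :
    PathAlgebra k (CyclicQuiver n) →ₗ[k] A :=
  (PathAlgebra.basis k).constr k fun q => y ^ q.2.2.length * e (cyclicIndex q.1)

theorem cyclicLiftLinear_ofPath {a b : CyclicQuiver n} (q : Quiver.Path a b) :
    cyclicLiftLinear k e y (ofPath k q) = y ^ q.length * e (cyclicIndex a) :=
  (PathAlgebra.basis k).constr_basis k _ ⟨a, b, q⟩

/-- Moving the right-hand idempotent across y^(length) turns it into the idempotent at the end of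
the second path. Orthogonality then reproduces the rule that non-composable paths multiply to zero.
-/
theorem cyclicLiftLinear_mul (he : CompleteOrthogonalIdempotents e)
    (hy : ∀ i, y * e i = e (i + 1) * y) (f g : PathAlgebra k (CyclicQuiver n)) :
    cyclicLiftLinear k e y (f * g) = cyclicLiftLinear k e y f * cyclicLiftLinear k e y g := by
  refine PathAlgebra.induction_on
    (P := fun f => cyclicLiftLinear k e y (f * g) = cyclicLiftLinear k e y f * _) f (by simp)
    (fun f f' hf hf' => by rw [add_mul, map_add, hf, hf', map_add, add_mul])
    (fun c f hf => by rw [smul_mul_assoc, map_smul, hf, map_smul, smul_mul_assoc])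
    fun {a b} q => ?_
  refine PathAlgebra.induction_on
    (P := fun g => cyclicLiftLinear k e y (_ * g) = _ * cyclicLiftLinear k e y g) g (by simp)
    (fun f f' hf hf' => by rw [mul_add, map_add, hf, hf', map_add, mul_add])
    (fun c f hf => by rw [mul_smul_comm, map_smul, hf, map_smul, mul_smul_comm])
    fun {c d} r => ?_
  have hd := length_path_cyclicQuiver r
  rw [cyclicLiftLinear_ofPath, cyclicLiftLinear_ofPath, pow_mul_of_shift hy r.length,
    mul_assoc, ← mul_assoc (e (cyclicIndex a))]
  by_cases hda : d = a
  · subst hda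
    rw [ofPath_mul_ofPath, cyclicLiftLinear_ofPath, Quiver.Path.length_comp, ← hd]
    rw [(he.idem _).eq, hd, ← pow_mul_of_shift hy, ← mul_assoc, ← pow_add, add_comm]
  · rw [ofPath_mul_ofPath_of_ne _ _ hda, ← hd, he.ortho (Ne.symm hda)]
    simp

theorem cyclicLiftLinear_eq_zero (hyt : y ^ t = 0) {f : PathAlgebra k (CyclicQuiver n)}
    (hf : f ∈ arrowIdeal k (CyclicQuiver n) ^ t) : cyclicLiftLinear k e y f = 0 := by
  have h : longPaths k (CyclicQuiver n) t ≤ LinearMap.ker (cyclicLiftLinear k e y) := by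
    rw [longPaths, Submodule.span_le]
    rintro _ ⟨a, b, q, hq, rfl⟩
    rw [SetLike.mem_coe, LinearMap.mem_ker, cyclicLiftLinear_ofPath, pow_eq_zero_of_le hq hyt,
      zero_mul]
  exact h (mem_longPaths_of_mem_arrowIdeal_pow hf)

/-- The universal property of the truncated path algebra of the cyclic quiver. -/
def cyclicLift (he : CompleteOrthogonalIdempotents e) (hy : ∀ i, y * e i = e (i + 1) * y)
    (hyt : y ^ t = 0) : CyclicTruncated k n t →ₐ[k] A :=
  Ideal.Quotient.liftₐ _ (AlgHom.ofLinearMap (cyclicLiftLinear k e y)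
    (by
      rw [PathAlgebra.one_eq, map_sum, ← he.complete]
      refine Finset.sum_congr rfl fun i _ => ?_
      rw [cyclicLiftLinear_ofPath, Quiver.Path.length_nil, pow_zero, one_mul])
    (cyclicLiftLinear_mul he hy)) fun _ hf => cyclicLiftLinear_eq_zero hyt hf

variable (he : CompleteOrthogonalIdempotents e) (hy : ∀ i, y * e i = e (i + 1) * y)
    (hyt : y ^ t = 0)

theorem cyclicLift_vertexIdem (i : ZMod (n + 1)) :
    cyclicLift (k := k) he hy hyt (vertexIdem k n t i) = e i := by
  change cyclicLiftLinear k e y _ = _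
  rw [cyclicLiftLinear_ofPath, Quiver.Path.length_nil, pow_zero, one_mul]

theorem cyclicLift_arrowSum : cyclicLift (k := k) he hy hyt (arrowSum k n t) = y := by
  change cyclicLiftLinear k e y _ = _
  rw [map_sum]
  trans ∑ i, y * e i
  · refine Finset.sum_congr rfl fun i _ => ?_
    rw [cyclicLiftLinear_ofPath]
    change y ^ 1 * _ = _
    rw [pow_one]
  · rw [← Finset.mul_sum, he.complete, mul_one]

theorem cyclicTruncated_algHom_ext {φ ψ : CyclicTruncated k n t →ₐ[k] A}
    (h : ∀ i, φ (vertexIdem k n t i) = ψ (vertexIdem k n t i))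
    (h' : φ (arrowSum k n t) = ψ (arrowSum k n t)) : φ = ψ := by
  ext f
  refine cyclicTruncated_induction (P := fun f => φ f = ψ f) f (by simp)
    (fun f g hf hg => by rw [map_add, hf, hg, map_add])
    (fun c f hf => by rw [map_smul, hf, map_smul]) fun m i => ?_
  rw [map_mul, map_pow, h, h', map_mul, map_pow]

end Lift

variable (k n t) in
/-- The paths of length less than `t`. -/
def shortPath (s : ZMod (n + 1) × Fin t) : CyclicTruncated k n t :=
  arrowSum k n t ^ (s.2 : ℕ) * vertexIdem k n t s.1

/-- Reading off the coefficients of the paths shorter than t kills all longer paths, so it descends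
to the quotient, where it sends the family to the standard basis. -/
theorem linearIndependent_shortPath : LinearIndependent k (shortPath k n t) := by
  classical
  let g : AnyPath (CyclicQuiver n) → (ZMod (n + 1) × Fin t → k) := fun q =>
    if h : q.2.2.length < t then Pi.single (cyclicIndex q.1, ⟨_, h⟩) 1 else 0
  let L := (PathAlgebra.basis k).constr k g
  have hL {a b : CyclicQuiver n} (q : Quiver.Path a b) : L (ofPath k q) = g ⟨a, b, q⟩ :=
    (PathAlgebra.basis k).constr_basis k _ ⟨a, b, q⟩
  have hLt : longPaths k (CyclicQuiver n) t ≤ LinearMap.ker L := by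
    rw [longPaths, Submodule.span_le]
    rintro _ ⟨a, b, q, hq, rfl⟩
    rw [SetLike.mem_coe, LinearMap.mem_ker, hL]
    exact dif_neg (not_lt.2 hq)
  let L' : CyclicTruncated k n t →ₗ[k] (ZMod (n + 1) × Fin t → k) :=
    { Submodule.liftQ ((arrowIdeal k (CyclicQuiver n) ^ t).restrictScalars k) L
        (fun f hf => hLt (mem_longPaths_of_mem_arrowIdeal_pow hf)) with }
  refine LinearIndependent.of_comp L' ?_
  have h : L' ∘ shortPath k n t = Pi.basisFun k _ := by
    funext s
    rw [Function.comp_apply, shortPath, ← mk_cyclicPath, Pi.basisFun_apply]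
    change L (ofPath k _) = _
    rw [hL]
    have hs : (cyclicPath n s.1 (s.2 : ℕ)).length < t := by
      rw [length_cyclicPath]; exact s.2.2
    have hs' : (⟨_, hs⟩ : Fin t) = s.2 := Fin.ext (length_cyclicPath n s.1 _)
    have : g ⟨_, _, cyclicPath n s.1 (s.2 : ℕ)⟩ = Pi.single (s.1, ⟨_, hs⟩) 1 := dif_pos hs
    rw [this, hs']
  rw [h]
  exact (Pi.basisFun k _).linearIndependent

theorem span_shortPath : ⊤ ≤ Submodule.span k (Set.range (shortPath k n t)) := by
  intro f _
  refine cyclicTruncated_induction (P := fun f => f ∈ Submodule.span k _) f (zero_mem _)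
    (fun _ _ => add_mem) (fun c _ => Submodule.smul_mem _ c) fun m i => ?_
  by_cases hm : m < t
  · exact Submodule.subset_span ⟨(i, ⟨m, hm⟩), rfl⟩
  · rw [pow_eq_zero_of_le (not_lt.1 hm) (arrowSum_pow k n t), zero_mul]
    exact zero_mem _

theorem finrank_cyclicTruncated :
    Module.finrank k (CyclicTruncated k n t) = (n + 1) * t := by
  rw [Module.finrank_eq_card_basis
    (Module.Basis.mk (linearIndependent_shortPath (k := k)) span_shortPath)]
  simp [ZMod.card]

/-- The longest paths lie in the radical of every symmetric associative form, unless they are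
closed. -/
theorem not_isSymmetricAlgebra_cyclicTruncated (ht : ((t : ℕ) : ZMod (n + 1)) ≠ 0) :
    ¬ IsSymmetricAlgebra k (CyclicTruncated k n (t + 1)) := by
  rintro ⟨B, hB, hsymm, hassoc⟩
  have hE := completeOrthogonalIdempotents_vertexIdem k n (t + 1)
  have hYE := arrowSum_mul_vertexIdem k n (t + 1)
  set E := vertexIdem k n (t + 1)
  set Y := arrowSum k n (t + 1)
  have hYt : Y ^ (t + 1) = 0 := arrowSum_pow k n (t + 1)
  set w := Y ^ t * E 0
  have hw : w ≠ 0 :=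
    (linearIndependent_shortPath (k := k) (n := n) (t := t + 1)).ne_zero (0, Fin.last t)
  have hwE : w = E t * w := by
    rw [← mul_assoc, ← zero_add ((t : ℕ) : ZMod (n + 1)), mul_assoc]
    change _ = E (0 + t) * (Y ^ t * E 0)
    rw [pow_mul_of_shift hYE, ← mul_assoc, (hE.idem _).eq, ← pow_mul_of_shift hYE]
  -- Since w = E t * w, the pairing equals B (E t) (w * E i), which vanishes for i ≠ 0. For i = 0
  -- symmetry and associativity turn it into B (w * E t) 1, and w * E t = 0 because w starts at 0 ≠
  -- t.
  have key (i : ZMod (n + 1)) : B w (E i) = 0 := by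
    have h1 : B w (E i) = B (E t) (w * E i) := by
      conv_lhs => rw [hwE]
      rw [hassoc]
    rw [h1, mul_assoc]
    by_cases hi : 0 = i
    · rw [← hi, (hE.idem _).eq, hsymm, ← mul_one (E t), ← hassoc]
      change B (Y ^ t * E 0 * E t) 1 = 0
      rw [mul_assoc, hE.ortho ht.symm]
      simp
    · rw [hE.ortho hi]
      simp
  refine hw (hB.1 w fun a => ?_)
  refine cyclicTruncated_induction (P := fun a => B w a = 0) a (map_zero _)
    (fun f g hf hg => by rw [map_add, hf, hg, add_zero])
    (fun c f hf => by rw [map_smul, hf, smul_zero]) fun m i => ?_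
  cases m with
  | zero => rw [pow_zero, one_mul]; exact key i
  | succ m =>
    have h1 : B w (Y ^ (m + 1) * E i) = B (E t) (w * (Y ^ (m + 1) * E i)) := by
      conv_lhs => rw [hwE]
      rw [hassoc]
    -- The product would be a path with at least t + 1 arrows.
    have h2 : w * (Y ^ (m + 1) * E i) = 0 := by
      have h3 : E 0 * Y = Y * E (-1) := by
        have := hYE (-1)
        rw [neg_add_cancel] at this
        exact this.symm
      change Y ^ t * E 0 * _ = 0
      rw [pow_succ', mul_assoc, mul_assoc, ← mul_assoc (E 0), h3, ← mul_assoc, ← mul_assoc,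
        ← mul_assoc, ← pow_succ, hYt]
      simp
    exact h1.trans (by rw [h2, map_zero])

end Truncated

theorem isSymmetricAlgebra_of_algEquiv {k A B : Type*} [Field k] [Ring A] [Algebra k A] [Ring B]
    [Algebra k B] (φ : A ≃ₐ[k] B) (h : IsSymmetricAlgebra k A) : IsSymmetricAlgebra k B := by
  obtain ⟨F, hF, hsymm, hassoc⟩ := h
  refine ⟨LinearMap.BilinForm.congr φ.toLinearEquiv F, hF.congr φ.toLinearEquiv, ?_, ?_⟩
  · intro a b
    exact hsymm _ _
  · intro a b c
    change F (φ.symm (a * b)) (φ.symm c) = F (φ.symm a) (φ.symm (b * c))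
    rw [map_mul φ.symm, map_mul φ.symm]
    exact hassoc _ _ _

/-! ### Algebras given by three generators and relations. -/

section Presentations

variable {k A : Type*} [Field k] [Ring A] [Algebra k A]
variable (r : FreeAlgebra k (Fin 3) → FreeAlgebra k (Fin 3) → Prop)

/-- The class of a generator in an algebra given by generators and relations. -/
abbrev relGen (i : Fin 3) : RingQuot r := RingQuot.mkAlgHom k r (FreeAlgebra.ι k i)

variable {r}

/-- The homomorphism from an algebra given by generators and relations with given values on the
generators. -/
def relLift (g : Fin 3 → A)
    (hg : ∀ ⦃a b⦄, r a b → FreeAlgebra.lift k g a = FreeAlgebra.lift k g b) :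
    RingQuot r →ₐ[k] A :=
  RingQuot.liftAlgHom k ⟨FreeAlgebra.lift k g, hg⟩

theorem relLift_relGen (g : Fin 3 → A)
    (hg : ∀ ⦃a b⦄, r a b → FreeAlgebra.lift k g a = FreeAlgebra.lift k g b) (i : Fin 3) :
    relLift g hg (relGen r i) = g i := by
  rw [relLift, RingQuot.liftAlgHom_mkAlgHom_apply, FreeAlgebra.lift_ι_apply]

theorem ringQuot_induction {P : RingQuot r → Prop} (a : RingQuot r)
    (halg : ∀ c : k, P (algebraMap k _ c)) (hgen : ∀ i, P (relGen r i))
    (hadd : ∀ a b, P a → P b → P (a + b)) (hmul : ∀ a b, P a → P b → P (a * b)) : P a := by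
  obtain ⟨a, rfl⟩ := RingQuot.mkAlgHom_surjective k r a
  induction a using FreeAlgebra.induction with
  | grade0 c => rw [AlgHom.commutes]; exact halg c
  | grade1 i => exact hgen i
  | mul a b ha hb => rw [map_mul]; exact hmul _ _ ha hb
  | add a b ha hb => rw [map_add]; exact hadd _ _ ha hb

theorem ringQuot_algHom_ext {φ ψ : RingQuot r →ₐ[k] A}
    (h : ∀ i, φ (relGen r i) = ψ (relGen r i)) : φ = ψ := by
  ext a
  exact h a

theorem commute_of_commute_relGen {c : RingQuot r} (h : ∀ i, Commute c (relGen r i))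
    (a : RingQuot r) : Commute c a :=
  ringQuot_induction a (fun s => (Algebra.commutes s c).symm) h (fun _ _ => Commute.add_right)
    fun _ _ => Commute.mul_right

/-- Centrality lets c pass from one factor of a product to the other. This is how a composite is
shown to be the identity on a single block, although it is not the identity globally. -/
theorem central_mul_algHom_eq {c : A} (hc : ∀ a, Commute c a) {f g : RingQuot r →ₐ[k] A}
    (h : ∀ i, c * f (relGen r i) = c * g (relGen r i)) (a : RingQuot r) : c * f a = c * g a := by
  refine ringQuot_induction (P := fun a => c * f a = c * g a) a
    (fun s => by rw [AlgHom.commutes, AlgHom.commutes]) h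
    (fun a b ha hb => by rw [map_add, mul_add, ha, hb, map_add, mul_add]) fun a b ha hb => ?_
  rw [map_mul, map_mul, ← mul_assoc, ha, (hc (g a)).eq, mul_assoc, hb, ← mul_assoc, ← mul_assoc,
    (hc (g a)).eq]

variable {n t : ℕ}

theorem nonempty_algEquiv_cyclicTruncated {e : ZMod (n + 1) → RingQuot r} {y : RingQuot r}
    (he : CompleteOrthogonalIdempotents e) (hy : ∀ i, y * e i = e (i + 1) * y) (hyt : y ^ t = 0)
    (φ : RingQuot r →ₐ[k] CyclicTruncated k n t) (hφe : ∀ i, φ (e i) = vertexIdem k n t i)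
    (hφy : φ y = arrowSum k n t)
    (hgen : ∀ i, cyclicLift (k := k) he hy hyt (φ (relGen r i)) = relGen r i) :
    Nonempty (RingQuot r ≃ₐ[k] CyclicTruncated k n t) := by
  refine ⟨AlgEquiv.ofAlgHom φ (cyclicLift he hy hyt) (cyclicTruncated_algHom_ext (fun i => ?_) ?_)
    (ringQuot_algHom_ext hgen)⟩
  · rw [AlgHom.comp_apply, cyclicLift_vertexIdem, hφe]; rfl
  · rw [AlgHom.comp_apply, cyclicLift_arrowSum, hφy]; rfl

end Presentations

/-- Induction gives [x, y^m] = m y^m, and p = 0 in the algebra. -/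
theorem commute_pow_char_of_commutator (p : ℕ) (k : Type*) {A : Type*}
    [Field k] [CharP k p] [Ring A] [Algebra k A] {x y : A}
    (h : x * y - y * x = y) : Commute x (y ^ p) := by
  have key (m : ℕ) : x * y ^ m = y ^ m * x + (m : A) * y ^ m := by
    induction m with
    | zero => simp
    | succ m ih =>
      have h' : x * y = y * x + y := by rw [← sub_eq_iff_eq_add', h]
      have h2 := (Nat.cast_commute m y).eq
      rw [pow_succ', ← mul_assoc, h', add_mul, mul_assoc, ih, mul_add, Nat.cast_succ, add_mul,
        one_mul, ← mul_assoc, ← mul_assoc, ← mul_assoc, h2]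
      abel
  have hp : ((p : ℕ) : A) = 0 := by
    rw [← map_natCast (algebraMap k A), CharP.cast_eq_zero, map_zero]
  have := key p
  rwa [hp, zero_mul, add_zero] at this

/-! ### Diagonal elements with eigenvalues in the prime field. -/

section Weights

variable (p : ℕ) [Fact p.Prime] {k A I : Type*} [Field k] [CharP k p] [Ring A] [Algebra k A]
  [Fintype I] {e : I → A} (he : CompleteOrthogonalIdempotents e)

/-- The diagonal element with given eigenvalues in the prime field. -/
def weightElem (k : Type*) [Field k] [CharP k p] [Algebra k A] (c : I → ZMod p) : A :=
  diagHom k he fun i => primeHom p k (c i)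

theorem weightElem_pow_char (c : I → ZMod p) : weightElem p he k c ^ p = weightElem p he k c := by
  rw [weightElem, ← map_pow]
  congr 1
  funext i
  exact primeHom_pow p _

theorem commute_weightElem (c c' : I → ZMod p) :
    Commute (weightElem p he k c) (weightElem p he k c') :=
  (Commute.all _ _).map (diagHom k he)

theorem weightElem_mul_sub_mul_weightElem (τ : I ≃ I) {y : A} (hy : ∀ i, y * e i = e (τ i) * y)
    (c d : I → ZMod p) (hc : ∀ i, c (τ i) = c i + d i) :
    weightElem p he k c * y - y * weightElem p he k c = y * weightElem p he k d := by
  rw [weightElem, diagHom_mul_of_shift he τ hy, ← mul_sub, ← map_sub, weightElem]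
  congr 2
  funext i
  simp [hc]

theorem weightElem_one : weightElem p he k (fun _ => 1) = 1 := by
  rw [weightElem, ← map_one (diagHom k he)]
  congr 1
  funext i
  exact map_one _

theorem weightElem_commutator (τ : I ≃ I) {y : A} (hy : ∀ i, y * e i = e (τ i) * y)
    (c : I → ZMod p) (hc : ∀ i, c (τ i) = c i + 1) :
    weightElem p he k c * y - y * weightElem p he k c = y := by
  rw [weightElem_mul_sub_mul_weightElem p he τ hy c (fun _ => 1) hc, weightElem_one, mul_one]

theorem aeval_weightElem (c d : I → ZMod p) (q : k[X])
    (hq : ∀ i, q.eval (primeHom p k (c i)) = primeHom p k (d i)) :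
    aeval (weightElem p he k c) q = weightElem p he k d := by
  rw [weightElem, aeval_algHom_apply, weightElem]
  congr 1
  funext i
  rw [← hq]
  have h := aeval_algHom_apply (Pi.evalAlgHom k (fun _ : I => k) i)
    (fun i => primeHom p k (c i)) q
  exact h.symm

theorem eigenIdem_weightElem (c : I → ZMod p) (a : ZMod p) :
    eigenIdem p k (weightElem p he k c) a = diagHom k he fun i => if c i = a then 1 else 0 := by
  rw [weightElem, ← map_eigenIdem, eigenIdem_pi]

/-- Distinct eigenvalues separate the indices, so the vertex idempotents are recovered as
polynomials in one diagonal element. -/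
theorem eigenIdem_weightElem_of_injective {c : I → ZMod p} (hc : Function.Injective c) (i : I) :
    eigenIdem p k (weightElem p he k c) (c i) = e i := by
  classical
  rw [eigenIdem_weightElem, ← diagHom_single (k := k) he i]
  congr 1
  funext j
  simp [Pi.single_apply, hc.eq_iff]

theorem map_weightElem {B : Type*} [Ring B] [Algebra k B] (φ : A →ₐ[k] B) (c : I → ZMod p) :
    φ (weightElem p he k c) = ∑ i, primeHom p k (c i) • φ (e i) := by
  simp [weightElem, diagHom_apply]

end Weights

/-! ### The cycle with p vertices, indexed by the prime field. -/

section PrimeCycle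

variable (p : ℕ) [Fact p.Prime]

/-- The vertices of the quiver with `p` vertices are the elements of the prime field. -/
def primeIndex : ZMod (p - 1 + 1) ≃+* ZMod p :=
  ZMod.ringEquivCongr (Nat.sub_add_cancel (Fact.out : p.Prime).one_le)

variable {k A : Type*} [Field k] [CharP k p] [Ring A] [Algebra k A]

/-- The spectral projections of `x`, indexed by the vertices of the quiver. -/
def primeIdem (k : Type*) [Field k] [CharP k p] [Algebra k A] (x : A) (i : ZMod (p - 1 + 1)) : A :=
  eigenIdem p k x (primeIndex p i)

theorem completeOrthogonalIdempotents_primeIdem {x : A} (hx : x ^ p = x) :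
    CompleteOrthogonalIdempotents (primeIdem p k x) :=
  (CompleteOrthogonalIdempotents.equiv (primeIndex p).toEquiv).2
    (completeOrthogonalIdempotents_eigenIdem p hx)

theorem mul_primeIdem {x y : A} (h : x * y - y * x = y) (i : ZMod (p - 1 + 1)) :
    y * primeIdem p k x i = primeIdem p k x (i + 1) * y := by
  rw [primeIdem, mul_eigenIdem_of_commutator p h, primeIdem, map_add, map_one]

variable (k) (t : ℕ)

/-- The element of `kÃ_{p-1} / J ^ t` acting on the vertices by their indices. -/
def cyclicWeight : CyclicTruncated k (p - 1) t :=
  weightElem p (completeOrthogonalIdempotents_vertexIdem k (p - 1) t) k (primeIndex p)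

theorem cyclicWeight_pow_char : cyclicWeight p k t ^ p = cyclicWeight p k t :=
  weightElem_pow_char _ _ _

theorem cyclicWeight_commutator : cyclicWeight p k t * arrowSum k (p - 1) t -
    arrowSum k (p - 1) t * cyclicWeight p k t = arrowSum k (p - 1) t :=
  weightElem_commutator p _ (Equiv.addRight 1) (arrowSum_mul_vertexIdem k (p - 1) t) _
    fun i => by simp

variable {k t}

theorem primeIdem_cyclicWeight (i : ZMod (p - 1 + 1)) :
    primeIdem p k (cyclicWeight p k t) i = vertexIdem k (p - 1) t i :=
  eigenIdem_weightElem_of_injective p _ (primeIndex p).injective i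

theorem map_primeIdem {B : Type*} [Ring B] [Algebra k B] (φ : A →ₐ[k] B) (x : A)
    (i : ZMod (p - 1 + 1)) : φ (primeIdem p k x i) = primeIdem p k (φ x) i :=
  map_eigenIdem p φ x _

theorem cyclicLift_cyclicWeight {x y : A} (hx : x ^ p = x)
    (hy : ∀ i, y * primeIdem p k x i = primeIdem p k x (i + 1) * y) (hyt : y ^ t = 0) :
    cyclicLift (completeOrthogonalIdempotents_primeIdem p hx) hy hyt (cyclicWeight p k t) = x := by
  rw [cyclicWeight, map_weightElem]
  simp only [cyclicLift_vertexIdem]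
  exact ((primeIndex p).toEquiv.sum_comp
    (fun a => primeHom p k a • eigenIdem p k x a)).trans (sum_smul_eigenIdem p hx)

end PrimeCycle

/-! ### The algebra C12. -/

section C12

variable (p : ℕ) [Fact p.Prime] (k : Type*) [Field k] [CharP k p]

theorem nonempty_algC12_algEquiv :
    Nonempty (AlgC12 k p ≃ₐ[k] CyclicTruncated k (p - 1) (p ^ 2)) := by
  have hxy := RingQuot.mkAlgHom_rel k (RelC12.xy (k := k) (p := p))
  have hx := RingQuot.mkAlgHom_rel k (RelC12.xp (k := k) (p := p))
  have hz := RingQuot.mkAlgHom_rel k (RelC12.yp (k := k) (p := p))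
  have hzp := RingQuot.mkAlgHom_rel k (RelC12.zp (k := k) (p := p))
  simp only [map_sub, map_mul, map_pow, map_zero] at hxy hx hz hzp
  have hyt : relGen (RelC12 k p) 1 ^ (p ^ 2) = 0 := by rw [pow_two, pow_mul, hz, hzp]
  have hXY := cyclicWeight_commutator p k (p ^ 2)
  let φ : AlgC12 k p →ₐ[k] CyclicTruncated k (p - 1) (p ^ 2) :=
    relLift ![cyclicWeight p k _, arrowSum k _ _, arrowSum k _ _ ^ p] (by
      intro a b h
      cases h <;>
        simp only [map_sub, map_mul, map_pow, map_zero, FreeAlgebra.lift_ι_apply, Matrix.cons_val]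
      · exact hXY
      -- Here z goes to the p-th power of the arrow sum, so [x, z] = 0 is a consequence of [x, y] =
      -- y in characteristic p.
      · exact sub_eq_zero.2 (commute_pow_char_of_commutator p k hXY).eq
      · exact sub_eq_zero.2 (Commute.self_pow _ p).eq
      · exact cyclicWeight_pow_char p k _
      · rw [← pow_mul, ← pow_two, arrowSum_pow])
  have hφ (i) : φ (relGen _ i) = _ := relLift_relGen _ _ i
  refine nonempty_algEquiv_cyclicTruncated (completeOrthogonalIdempotents_primeIdem p hx)
    (mul_primeIdem (k := k) p hxy) hyt φ (fun i => ?_) (hφ 1) fun i => ?_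
  · rw [map_primeIdem, hφ 0, Matrix.cons_val_zero, primeIdem_cyclicWeight]
  · rw [hφ]
    fin_cases i
    · exact cyclicLift_cyclicWeight p hx _ _
    · exact cyclicLift_arrowSum _ _ _
    · change cyclicLift _ _ _ (arrowSum k (p - 1) _ ^ p) = _
      rw [map_pow, cyclicLift_arrowSum, hz]; rfl

end C12

/-! ### The algebra C13: splitting along a central element. -/

section C13

variable (p : ℕ) [Fact p.Prime] (k : Type*) [Field k] [CharP k p]

theorem nonempty_algC13_algEquiv :
    Nonempty (AlgC13 k p ≃ₐ[k] (Fin p → CyclicTruncated k (p - 1) p)) := by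
  have hxy := RingQuot.mkAlgHom_rel k (RelC13.xy (k := k) (p := p))
  have hxz := RingQuot.mkAlgHom_rel k (RelC13.xz (k := k) (p := p))
  have hyz := RingQuot.mkAlgHom_rel k (RelC13.yz (k := k) (p := p))
  have hx := RingQuot.mkAlgHom_rel k (RelC13.xp (k := k) (p := p))
  have hyt := RingQuot.mkAlgHom_rel k (RelC13.yp (k := k) (p := p))
  have hz := RingQuot.mkAlgHom_rel k (RelC13.zp (k := k) (p := p))
  simp only [map_sub, map_mul, map_pow, map_zero, sub_eq_zero] at hxy hxz hyz hx hyt hz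
  have hzc (a : AlgC13 k p) : Commute a (relGen (RelC13 k p) 2) :=
    (commute_of_commute_relGen (fun i => by
      fin_cases i
      exacts [hxz.symm, hyz.symm, rfl]) a).symm
  let c : ZMod p → AlgC13 k p := eigenIdem p k (relGen (RelC13 k p) 2)
  have hc := completeOrthogonalIdempotents_eigenIdem (k := k) p hz
  have hcc (b : ZMod p) (a : AlgC13 k p) : Commute (c b) a :=
    (commute_eigenIdem p (hzc a) b).symm
  let φ (b : ZMod p) : AlgC13 k p →ₐ[k] CyclicTruncated k (p - 1) p :=
    relLift ![cyclicWeight p k _, arrowSum k _ _, algebraMap k _ (primeHom p k b)] (by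
      intro a b h
      cases h <;>
        simp only [map_sub, map_mul, map_pow, map_zero, FreeAlgebra.lift_ι_apply, Matrix.cons_val]
      · exact cyclicWeight_commutator p k p
      · exact sub_eq_zero.2 (Algebra.commutes _ _).symm
      · exact sub_eq_zero.2 (Algebra.commutes _ _).symm
      · exact cyclicWeight_pow_char p k _
      · exact arrowSum_pow k _ _
      · rw [← map_pow, primeHom_pow])
  have hφ (b i) : φ b (relGen _ i) = _ := relLift_relGen _ _ i
  have hφc (b b' : ZMod p) : φ b (c b') = if b = b' then 1 else 0 := by
    rw [map_eigenIdem, hφ]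
    exact eigenIdem_algebraMap p b' b
  -- The same map serves all blocks: it involves only x and y, and is a section of every `φ b`.
  let ψ : CyclicTruncated k (p - 1) p →ₐ[k] AlgC13 k p :=
    cyclicLift (completeOrthogonalIdempotents_primeIdem p hx) (mul_primeIdem (k := k) p hxy) hyt
  have hψX : ψ (cyclicWeight p k p) = _ := cyclicLift_cyclicWeight p hx _ _
  have hψY : ψ (arrowSum k _ p) = _ := cyclicLift_arrowSum _ _ _
  have hφψ (b : ZMod p) : (φ b).comp ψ = AlgHom.id k _ := by
    refine cyclicTruncated_algHom_ext (fun i => ?_) ?_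
    · rw [AlgHom.comp_apply, cyclicLift_vertexIdem, map_primeIdem, hφ, Matrix.cons_val_zero,
        primeIdem_cyclicWeight]; rfl
    · rw [AlgHom.comp_apply, hψY, hφ]; rfl
  have hψφ (b : ZMod p) (a : AlgC13 k p) : c b * ψ (φ b a) = c b * a := by
    refine central_mul_algHom_eq (hcc b) (f := ψ.comp (φ b)) (g := AlgHom.id k _) (fun i => ?_) a
    rw [AlgHom.comp_apply, hφ, AlgHom.id_apply]
    fin_cases i
    · exact congrArg _ hψX
    · exact congrArg _ hψY
    · change _ * ψ (algebraMap k _ _) = _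
      rw [AlgHom.commutes, ← Algebra.commutes, ← Algebra.smul_def, ← mul_eigenIdem p hz,
        (hcc b _).eq]
      rfl
  let β : Fin p ≃ ZMod p := (ZMod.finEquiv p).toEquiv
  refine ⟨AlgEquiv.ofBijective (AlgHom.pi fun i => φ (β i)) ⟨?_, fun m => ?_⟩⟩
  · rw [injective_iff_map_eq_zero]
    intro a ha
    rw [← one_mul a, ← hc.complete, Finset.sum_mul]
    refine Finset.sum_eq_zero fun b _ => ?_
    have h : φ b a = 0 := by
      have := congrFun ha (β.symm b)
      rwa [AlgHom.pi_apply, Equiv.apply_symm_apply] at this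
    exact (hψφ b a).symm.trans (by rw [h, map_zero, mul_zero])
  -- The components are glued by the central idempotents; `φ b` sends `c b` to 1 and the others to
  -- 0.
  · refine ⟨∑ b, c b * ψ (m (β.symm b)), ?_⟩
    funext i
    have h (b : ZMod p) (m) : φ b (ψ m) = m := DFunLike.congr_fun (hφψ b) m
    simp [hφc, h]

end C13

/-! ### The polynomial f and the single orbit of length p^2. -/

section ShiftPolynomial

variable (p : ℕ) (k : Type*) [Field k]

/-- The polynomial `f` of the algebra `B2`. -/
def shiftPoly : k[X] :=
  ∑ i ∈ Finset.Icc 1 (p - 1), C ((-1 : k) ^ (i - 1) * ((p : k) - (i : k))⁻¹) * X ^ i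

theorem map_polyF {A : Type*} [Ring A] [Algebra k A] (φ : FreeAlgebra k (Fin 3) →ₐ[k] A) :
    φ (polyF k p) = aeval (φ (genX k)) (shiftPoly p k) := by
  simp only [polyF, shiftPoly, map_sum, map_mul, map_pow, aeval_C, aeval_X, Algebra.smul_def,
    AlgHom.commutes]

variable [Fact p.Prime] [CharP k p]

/-- The values of the polynomial `f` on the prime field. -/
def shiftVal (a : ZMod p) : ZMod p := (shiftPoly p (ZMod p)).eval a

theorem eval_shiftPoly (a : ZMod p) :
    (shiftPoly p k).eval (primeHom p k a) = primeHom p k (shiftVal p a) := by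
  have h : shiftPoly p k = (shiftPoly p (ZMod p)).map (primeHom p k) := by
    simp only [shiftPoly, Polynomial.map_sum, Polynomial.map_mul, Polynomial.map_pow, map_C, map_X,
      map_mul, map_pow, map_neg, map_one, map_inv₀, map_sub, map_natCast, Polynomial.map_neg,
      Polynomial.map_one]
  rw [h, eval_map_apply]
  rfl

/-- The power sums over F_p vanish for exponents below p - 1 and equal -1 for p - 1, so only the top
coefficient (-1)^(p-2) contributes, giving (-1)^(p-1) = 1. -/
theorem sum_shiftVal : ∑ a, shiftVal p a = 1 := by
  have hp := (Fact.out : p.Prime).two_le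
  simp only [shiftVal, shiftPoly, eval_finsetSum, eval_mul, eval_C, eval_pow, eval_X]
  rw [Finset.sum_comm, Finset.sum_eq_single (p - 1)]
  · have h1 : ∑ a : ZMod p, a ^ (p - 1) = -1 := by
      have h2 (a : ZMod p) : a ^ (p - 1) = 1 - if a = 0 then 1 else 0 := by
        split_ifs with h
        · rw [h, zero_pow (by omega), sub_self]
        · rw [ZMod.pow_card_sub_one_eq_one h, sub_zero]
      simp [h2]
    have h3 : ((p - 1 : ℕ) : ZMod p) = -1 := by
      rw [Nat.cast_sub (by omega), CharP.cast_eq_zero, Nat.cast_one, zero_sub]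
    have h4 : (-1 : ZMod p) ^ (p - 1 - 1) * -1 = 1 := by
      rw [← pow_succ, Nat.sub_add_cancel (by omega),
        ZMod.pow_card_sub_one_eq_one (neg_ne_zero.2 one_ne_zero)]
    rw [← Finset.mul_sum, h1, h3, CharP.cast_eq_zero, zero_sub, neg_neg, inv_one, mul_one, h4]
  · intro i hi hne
    rw [← Finset.mul_sum, FiniteField.sum_pow_lt_card_sub_one, mul_zero]
    rw [ZMod.card]
    have := (Finset.mem_Icc.1 hi).2
    omega
  · intro h
    exact absurd (Finset.mem_Icc.2 ⟨by omega, le_rfl⟩) h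

/-- The orbit of the origin under `(a, b) ↦ (a + 1, b - f(a))`. -/
def shiftOrbit (m : ℕ) : ZMod p × ZMod p :=
  ((m : ZMod p), -∑ j ∈ Finset.range m, shiftVal p (j : ZMod p))

theorem shiftOrbit_succ (m : ℕ) : shiftOrbit p (m + 1) =
    ((shiftOrbit p m).1 + 1, (shiftOrbit p m).2 - shiftVal p (shiftOrbit p m).1) := by
  refine Prod.ext (Nat.cast_succ m) ?_
  simp only [shiftOrbit, Finset.sum_range_succ]
  ring

theorem sum_range_natCast_zmod {M : Type*} [AddCommMonoid M] (g : ZMod p → M) :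
    ∑ j ∈ Finset.range p, g (j : ZMod p) = ∑ a, g a := by
  refine Finset.sum_bij' (fun j _ => (j : ZMod p)) (fun a _ => a.val) (fun _ _ => Finset.mem_univ _)
    (fun a _ => Finset.mem_range.2 (ZMod.val_lt a))
    (fun j hj => ZMod.val_cast_of_lt (Finset.mem_range.1 hj)) (fun a _ => ZMod.natCast_zmod_val a)
    fun _ _ => rfl

/-- A block of p steps runs once through all first coordinates, so it restores the first coordinate
and lowers the second by the total sum of f, which is 1. -/
theorem shiftOrbit_add_mul (m j : ℕ) :
    shiftOrbit p (m + p * j) = ((shiftOrbit p m).1, (shiftOrbit p m).2 - j) := by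
  induction j with
  | zero => simp
  | succ j ih =>
    have h1 : ∑ i ∈ Finset.range p, shiftVal p ((m + p * j + i : ℕ) : ZMod p) = 1 := by
      have h2 (i : ℕ) : ((m + p * j + i : ℕ) : ZMod p) = (m : ZMod p) + (i : ZMod p) := by
        simp
      simp only [h2]
      rw [sum_range_natCast_zmod p fun a => shiftVal p ((m : ZMod p) + a)]
      exact (Equiv.sum_comp (Equiv.addLeft (m : ZMod p)) (shiftVal p)).trans (sum_shiftVal p)
    have h3 := congrArg Prod.snd ih
    simp only [shiftOrbit] at h3
    rw [Nat.mul_succ, ← add_assoc]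
    refine Prod.ext (by simp [shiftOrbit]) ?_
    simp only [shiftOrbit]
    rw [Finset.sum_range_add _ (m + p * j) p, h1, neg_add, h3]
    push_cast
    ring

theorem shiftOrbit_periodic : Function.Periodic (shiftOrbit p) (p ^ 2 - 1 + 1) := by
  intro m
  have h : p ^ 2 - 1 + 1 = p * p := by
    rw [Nat.sub_add_cancel (Nat.one_le_pow _ _ (Fact.out : p.Prime).pos), pow_two]
  rw [h, shiftOrbit_add_mul, CharP.cast_eq_zero, sub_zero]

theorem bijective_shiftOrbit :
    Function.Bijective fun i : ZMod (p ^ 2 - 1 + 1) => shiftOrbit p i.val := by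
  rw [Fintype.bijective_iff_surjective_and_card]
  constructor
  · rintro ⟨a, b⟩
    -- First a steps reach the right first coordinate, then whole rounds of p steps correct the
    -- second.
    refine ⟨((a.val + p * ((shiftOrbit p a.val).2 - b).val : ℕ) : ZMod _), ?_⟩
    simp only [ZMod.val_natCast]
    rw [(shiftOrbit_periodic p).map_mod_nat, shiftOrbit_add_mul]
    refine Prod.ext ?_ ?_
    · exact ZMod.natCast_zmod_val a
    · simp
  · rw [Fintype.card_prod, ZMod.card, ZMod.card,
      Nat.sub_add_cancel (Nat.one_le_pow _ _ (Fact.out : p.Prime).pos), pow_two]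

/-- The vertices of the quiver with `p ^ 2` vertices correspond to the pairs of eigenvalues. -/
def shiftIndex : ZMod (p ^ 2 - 1 + 1) ≃ ZMod p × ZMod p :=
  Equiv.ofBijective _ (bijective_shiftOrbit p)

theorem shiftIndex_add_one (i : ZMod (p ^ 2 - 1 + 1)) : shiftIndex p (i + 1) =
    ((shiftIndex p i).1 + 1, (shiftIndex p i).2 - shiftVal p (shiftIndex p i).1) := by
  change shiftOrbit p (i + 1).val = _
  rw [ZMod.val_add, ZMod.val_one_eq_one_mod, Nat.add_mod_mod, (shiftOrbit_periodic p).map_mod_nat,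
    shiftOrbit_succ]
  rfl

end ShiftPolynomial

/-! ### The algebra B2. -/

section B2

theorem not_isSymmetricAlgebra_cyclicTruncated_sq (p : ℕ) [Fact p.Prime] (k : Type*)
    [Field k] :
    ¬ IsSymmetricAlgebra k (CyclicTruncated k (p ^ 2 - 1) p) := by
  have hp := (Fact.out : p.Prime).two_le
  have h := not_isSymmetricAlgebra_cyclicTruncated (k := k) (n := p ^ 2 - 1) (t := p - 1) (by
    rw [Ne, ZMod.natCast_eq_zero_iff]
    -- A longest path is not closed, because 0 < p - 1 < p^2.
    refine Nat.not_dvd_of_pos_of_lt (by omega) ?_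
    have : p ≤ p ^ 2 := Nat.le_self_pow two_ne_zero p
    omega)
  rwa [Nat.sub_add_cancel (by omega)] at h

variable (p : ℕ) [Fact p.Prime] (k : Type*) [Field k] [CharP k p]

/-- On the a-eigenspace of x the element f(x) acts as the scalar f(a), so there y z = (z + f(a)) y:
applying y lowers the eigenvalue of z by f(a). -/
theorem mul_eigenIdem_mul_eigenIdem {A : Type*} [Ring A] [Algebra k A] {x y z : A}
    (hxy : x * y - y * x = y) (hxz : Commute x z)
    (hyz : y * z - z * y = y * aeval x (shiftPoly p k)) (hx : x ^ p = x) (a b : ZMod p) :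
    y * (eigenIdem p k z b * eigenIdem p k x a) =
      eigenIdem p k z (b - shiftVal p a) * eigenIdem p k x (a + 1) * y := by
  have hxz' : Commute z (eigenIdem p k x a) := commute_eigenIdem p hxz.symm a
  have h1 : y * eigenIdem p k x a * z =
      (z - algebraMap k A (primeHom p k (-shiftVal p a))) * (y * eigenIdem p k x a) := by
    have hyz' : y * z = z * y + y * aeval x (shiftPoly p k) := by rw [← sub_eq_iff_eq_add', hyz]
    rw [mul_assoc, ← hxz'.eq, ← mul_assoc, hyz', add_mul, mul_assoc y,
      aeval_mul_eigenIdem p hx, eval_shiftPoly, map_neg, map_neg, sub_neg_eq_add, add_mul,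
      mul_assoc, mul_smul_comm, Algebra.smul_def]
  have h2 := mul_aeval_of_semiconj h1 (deltaPoly p k b)
  rw [← eigenIdem, ← eigenIdem, eigenIdem_sub, ← sub_eq_add_neg] at h2
  rw [(commute_eigenIdem p hxz'.symm b).symm.eq, ← mul_assoc, h2,
    mul_eigenIdem_of_commutator p hxy, mul_assoc]

theorem nonempty_algB2_algEquiv :
    Nonempty (AlgB2 k p ≃ₐ[k] CyclicTruncated k (p ^ 2 - 1) p) := by
  have hxy := RingQuot.mkAlgHom_rel k (RelB2.xy (k := k) (p := p))
  have hxz := RingQuot.mkAlgHom_rel k (RelB2.xz (k := k) (p := p))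
  have hyz := RingQuot.mkAlgHom_rel k (RelB2.yz (k := k) (p := p))
  have hx := RingQuot.mkAlgHom_rel k (RelB2.xp (k := k) (p := p))
  have hyt := RingQuot.mkAlgHom_rel k (RelB2.yp (k := k) (p := p))
  have hz := RingQuot.mkAlgHom_rel k (RelB2.zp (k := k) (p := p))
  simp only [map_sub, map_mul, map_pow, map_zero, map_polyF] at hxy hxz hyz hx hyt hz
  have hxz' : Commute (relGen (RelB2 k p) 0) (relGen (RelB2 k p) 2) := sub_eq_zero.1 hxz
  let e (s : ZMod p × ZMod p) : AlgB2 k p :=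
    eigenIdem p k (relGen (RelB2 k p) 2) s.2 * eigenIdem p k (relGen (RelB2 k p) 0) s.1
  have he : CompleteOrthogonalIdempotents e :=
    completeOrthogonalIdempotents_mul (completeOrthogonalIdempotents_eigenIdem p hx)
      (completeOrthogonalIdempotents_eigenIdem p hz)
      fun a b => (commute_eigenIdem p (commute_eigenIdem p hxz' b).symm a)
  have hesum1 : ∑ s, primeHom p k s.1 • e s = relGen (RelB2 k p) 0 := by
    simp only [e, Fintype.sum_prod_type_right, ← mul_smul_comm, ← Finset.mul_sum,
      ← Finset.sum_mul, sum_smul_eigenIdem p hx,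
      (completeOrthogonalIdempotents_eigenIdem (k := k) p hz).complete, one_mul]
  have hesum2 : ∑ s, primeHom p k s.2 • e s = relGen (RelB2 k p) 2 := by
    simp only [e, Fintype.sum_prod_type, ← smul_mul_assoc, ← Finset.mul_sum,
      ← Finset.sum_mul, sum_smul_eigenIdem p hz,
      (completeOrthogonalIdempotents_eigenIdem (k := k) p hx).complete, mul_one]
  have hy (i) : relGen (RelB2 k p) 1 * (e ∘ shiftIndex p) i =
      (e ∘ shiftIndex p) (i + 1) * relGen (RelB2 k p) 1 := by
    rw [Function.comp_apply, Function.comp_apply, shiftIndex_add_one]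
    exact mul_eigenIdem_mul_eigenIdem p k hxy hxz' hyz hx _ _
  have hE := completeOrthogonalIdempotents_vertexIdem k (p ^ 2 - 1) p
  have hYE := arrowSum_mul_vertexIdem k (p ^ 2 - 1) p
  let c₁ (i : ZMod (p ^ 2 - 1 + 1)) : ZMod p := (shiftIndex p i).1
  let c₂ (i : ZMod (p ^ 2 - 1 + 1)) : ZMod p := (shiftIndex p i).2
  let φ : AlgB2 k p →ₐ[k] CyclicTruncated k (p ^ 2 - 1) p :=
    relLift ![weightElem p hE k c₁, arrowSum k _ _, weightElem p hE k c₂] (by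
      intro a b h
      cases h <;>
        simp only [map_sub, map_mul, map_pow, map_zero, map_polyF, FreeAlgebra.lift_ι_apply,
          Matrix.cons_val]
      · exact weightElem_commutator p hE (Equiv.addRight 1) hYE c₁
          fun i => congrArg Prod.fst (shiftIndex_add_one p i)
      · exact sub_eq_zero.2 (commute_weightElem p hE _ _).eq
      · rw [aeval_weightElem p hE c₁ (fun i => shiftVal p (c₁ i)) _
          fun i => eval_shiftPoly p k (c₁ i)]
        have h1 := weightElem_mul_sub_mul_weightElem (k := k) p hE (Equiv.addRight 1) hYE c₂
          (fun i => -shiftVal p (c₁ i)) fun i =>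
            (congrArg Prod.snd (shiftIndex_add_one p i)).trans (sub_eq_add_neg _ _)
        have h2 : weightElem p hE k (fun i => -shiftVal p (c₁ i)) =
            -weightElem p hE k fun i => shiftVal p (c₁ i) := by
          rw [weightElem, weightElem, ← map_neg]
          congr 1
          funext i
          exact map_neg _ _
        rw [h2] at h1
        rw [← neg_sub, h1, mul_neg, neg_neg]
      · exact weightElem_pow_char _ _ _
      · exact arrowSum_pow k _ _
      · exact weightElem_pow_char _ _ _)
  have hφ (i) : φ (relGen _ i) = _ := relLift_relGen _ _ i
  have he' := (CompleteOrthogonalIdempotents.equiv (shiftIndex p)).2 he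
  refine nonempty_algEquiv_cyclicTruncated he' hy hyt φ (fun i => ?_) (hφ 1) fun i => ?_
  · rw [Function.comp_apply, map_mul, map_eigenIdem, map_eigenIdem, hφ 0, hφ 2]
    change eigenIdem p k (weightElem p hE k c₂) _ * eigenIdem p k (weightElem p hE k c₁) _ = _
    rw [eigenIdem_weightElem, eigenIdem_weightElem, ← map_mul, ← diagHom_single (k := k) hE i]
    congr 1
    funext j
    -- Neither weight alone separates the p^2 vertices; the pair does, so the product of the two
    -- projections is a single vertex idempotent.
    have h : j = i ↔ c₂ j = c₂ i ∧ c₁ j = c₁ i := by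
      rw [← (shiftIndex p).injective.eq_iff, Prod.ext_iff, and_comm]
    simp only [Pi.mul_apply, Pi.single_apply, h, ite_and, ite_mul, one_mul, zero_mul]
    rfl
  · rw [hφ]
    fin_cases i
    · change cyclicLift _ _ _ (weightElem p hE k c₁) = _
      rw [map_weightElem]
      simp only [cyclicLift_vertexIdem]
      exact ((shiftIndex p).sum_comp fun s => primeHom p k s.1 • e s).trans hesum1
    · exact cyclicLift_arrowSum _ _ _
    · change cyclicLift _ _ _ (weightElem p hE k c₂) = _
      rw [map_weightElem]
      simp only [cyclicLift_vertexIdem]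
      exact ((shiftIndex p).sum_comp fun s => primeHom p k s.2 • e s).trans hesum2

end B2

/-! ### The cyclic permutation matrix. -/

section MatrixAlgebra

variable (p : ℕ) [Fact p.Prime] (k : Type*) [Field k]

/-- The matrix of the cyclic shift of the standard basis. -/
def shiftMatrix : Matrix (ZMod p) (ZMod p) k := ∑ i, Matrix.single (i + 1) i 1

variable {p k}

theorem shiftMatrix_mul_single (i j : ZMod p) :
    shiftMatrix p k * Matrix.single i j 1 = Matrix.single (i + 1) j 1 := by
  rw [shiftMatrix, Finset.sum_mul, Finset.sum_eq_single i]
  · simp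
  · intro l _ hl
    exact Matrix.single_mul_single_of_ne _ _ _ _ hl _
  · simp

theorem shiftMatrix_pow_mul_single (m : ℕ) (i j : ZMod p) :
    shiftMatrix p k ^ m * Matrix.single i j 1 = Matrix.single (i + m) j 1 := by
  induction m with
  | zero => simp
  | succ m ih => rw [pow_succ', mul_assoc, ih, shiftMatrix_mul_single, Nat.cast_succ, add_assoc]

theorem single_mul_shiftMatrix (i : ZMod p) :
    Matrix.single (i + 1) (i + 1) 1 * shiftMatrix p k = Matrix.single (i + 1) i 1 := by
  rw [shiftMatrix, Finset.mul_sum, Finset.sum_eq_single i]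
  · simp
  · intro l _ hl
    exact Matrix.single_mul_single_of_ne _ _ _ _ (fun h => hl (add_right_cancel h).symm) _
  · simp

variable (p k)

theorem completeOrthogonalIdempotents_single :
    CompleteOrthogonalIdempotents fun i : ZMod p => Matrix.single i i (1 : k) where
  idem i := by
    change _ * _ = _
    simp
  ortho i j hij := Matrix.single_mul_single_of_ne _ _ _ _ hij _
  complete := Matrix.sum_single_one

theorem shiftMatrix_pow_card : shiftMatrix p k ^ p = 1 := by
  rw [← mul_one (shiftMatrix p k ^ p), ← (completeOrthogonalIdempotents_single p k).complete,
    Finset.mul_sum]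
  simp only [shiftMatrix_pow_mul_single, CharP.cast_eq_zero, add_zero]

end MatrixAlgebra

/-! ### Recovering a block from its matrix representation. -/

section MatrixComponent

variable (p : ℕ) [Fact p.Prime] {k A : Type*} [Field k] [Ring A] [Algebra k A]

/-- The linear map from matrices determined by a shift `u`, idempotents `e` and a central element
`c`. -/
def matrixLift (k : Type*) [Field k] [Algebra k A] (c u : A) (e : ZMod p → A) :
    Matrix (ZMod p) (ZMod p) k →ₗ[k] A :=
  (Matrix.stdBasis k (ZMod p) (ZMod p)).constr k fun s => c * u ^ (s.1 - s.2).val * e s.2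

theorem matrixLift_single (c u : A) (e : ZMod p → A) (i j : ZMod p) :
    matrixLift p k c u e (Matrix.single i j 1) = c * u ^ (i - j).val * e j := by
  have h := (Matrix.stdBasis k (ZMod p) (ZMod p)).constr_basis k
    (fun s => c * u ^ (s.1 - s.2).val * e s.2) (i, j)
  rwa [Matrix.stdBasis_eq_single] at h

variable {c u : A} {e : ZMod p → A}

theorem matrixLift_one (he : CompleteOrthogonalIdempotents e) : matrixLift p k c u e 1 = c := by
  rw [← Matrix.sum_single_one, map_sum]
  simp only [matrixLift_single, sub_self, ZMod.val_zero, pow_zero, mul_one, ← Finset.mul_sum,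
    he.complete]

theorem mul_pow_mod_of_mul_pow {M : Type*} [Monoid M] {c u : M} {q : ℕ} (h : c * u ^ q = c)
    (m : ℕ) : c * u ^ (m % q) = c * u ^ m := by
  have key (l : ℕ) : c * (u ^ q) ^ l = c := by
    induction l with
    | zero => simp
    | succ l ih => rw [pow_succ', ← mul_assoc, h, ih]
  conv_rhs => rw [← Nat.mod_add_div m q, add_comm, pow_add, pow_mul, ← mul_assoc, key]

/-- The exponent (i - j).val may wrap around when i increases; this is harmless since c u^p = c
makes c u^m depend only on m modulo p. -/
theorem matrixLift_shiftMatrix_mul (hc : Commute c u) (hu : c * u ^ p = c)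
    (M : Matrix (ZMod p) (ZMod p) k) :
    matrixLift p k c u e (shiftMatrix p k * M) = u * matrixLift p k c u e M := by
  suffices h : matrixLift p k c u e ∘ₗ LinearMap.mulLeft k (shiftMatrix p k) =
      LinearMap.mulLeft k u ∘ₗ matrixLift p k c u e from LinearMap.congr_fun h M
  refine (Matrix.stdBasis k (ZMod p) (ZMod p)).ext fun s => ?_
  rw [Matrix.stdBasis_eq_single]
  simp only [LinearMap.comp_apply, LinearMap.mulLeft_apply, shiftMatrix_mul_single,
    matrixLift_single]
  have h : s.1 + 1 - s.2 = s.1 - s.2 + 1 := by ring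
  rw [h, ZMod.val_add, ZMod.val_one_eq_one_mod, Nat.add_mod_mod, mul_pow_mod_of_mul_pow hu,
    pow_succ', ← mul_assoc, ← mul_assoc, ← mul_assoc, hc.eq]

theorem map_matrixLift (φ : A →ₐ[k] Matrix (ZMod p) (ZMod p) k) (hc : φ c = 1)
    (hu : φ u = shiftMatrix p k) (he : ∀ i, φ (e i) = Matrix.single i i 1)
    (M : Matrix (ZMod p) (ZMod p) k) : φ (matrixLift p k c u e M) = M := by
  suffices h : φ.toLinearMap ∘ₗ matrixLift p k c u e = LinearMap.id from LinearMap.congr_fun h M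
  refine (Matrix.stdBasis k (ZMod p) (ZMod p)).ext fun s => ?_
  rw [Matrix.stdBasis_eq_single, LinearMap.comp_apply, matrixLift_single, AlgHom.toLinearMap_apply,
    map_mul, map_mul, map_pow, hc, hu, he, one_mul, shiftMatrix_pow_mul_single,
    ZMod.natCast_zmod_val, add_sub_cancel, LinearMap.id_apply]

variable [CharP k p]

/-- The image of the matrix unit (i, j) is c e_i u^(i-j), on which x acts by i, as the diagonal
matrix does on row i. -/
theorem matrixLift_weightElem_mul {x : A} (hx : ∀ i, x * e i = primeHom p k i • e i)
    (hcx : Commute c x) (hu : ∀ i, u * e i = e (i + 1) * u) (M : Matrix (ZMod p) (ZMod p) k) :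
    matrixLift p k c u e (weightElem p (completeOrthogonalIdempotents_single p k) k id * M) =
      x * matrixLift p k c u e M := by
  suffices h : matrixLift p k c u e ∘ₗ LinearMap.mulLeft k
      (weightElem p (completeOrthogonalIdempotents_single p k) k id) =
      LinearMap.mulLeft k x ∘ₗ matrixLift p k c u e from LinearMap.congr_fun h M
  refine (Matrix.stdBasis k (ZMod p) (ZMod p)).ext fun s => ?_
  rw [Matrix.stdBasis_eq_single]
  have h1 : weightElem p (completeOrthogonalIdempotents_single p k) k id *
      Matrix.single s.1 s.2 1 = primeHom p k s.1 • Matrix.single s.1 s.2 1 := by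
    rw [weightElem, diagHom_apply, Finset.sum_mul, Finset.sum_eq_single s.1]
    · rw [smul_mul_assoc, Matrix.single_mul_single_same, mul_one, id]
    · intro l _ hl
      rw [smul_mul_assoc, Matrix.single_mul_single_of_ne _ _ _ _ hl, smul_zero]
    · simp
  have h2 : u ^ (s.1 - s.2).val * e s.2 = e s.1 * u ^ (s.1 - s.2).val := by
    rw [pow_mul_of_shift hu, ZMod.natCast_zmod_val, add_sub_cancel]
  rw [LinearMap.comp_apply, LinearMap.comp_apply, LinearMap.mulLeft_apply,
    LinearMap.mulLeft_apply, h1, map_smul, matrixLift_single, mul_assoc, h2, ← mul_assoc,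
    ← mul_assoc, ← mul_assoc x, ← hcx.eq, mul_assoc c x, hx, mul_smul_comm, smul_mul_assoc]

end MatrixComponent

/-! ### The algebra C14: one nilpotent block and p - 1 matrix blocks. -/

section C14

variable (p : ℕ) [Fact p.Prime] (k : Type*) [Field k] [CharP k p]

theorem nonempty_algC14_algEquiv :
    Nonempty (AlgC14 k p ≃ₐ[k]
      (CyclicTruncated k (p - 1) p × (Fin (p - 1) → Matrix (Fin p) (Fin p) k))) := by
  have hp := (Fact.out : p.Prime).ne_zero
  have hxy := RingQuot.mkAlgHom_rel k (RelC14.xy (k := k) (p := p))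
  have hxz := RingQuot.mkAlgHom_rel k (RelC14.xz (k := k) (p := p))
  have hyz := RingQuot.mkAlgHom_rel k (RelC14.yz (k := k) (p := p))
  have hx := RingQuot.mkAlgHom_rel k (RelC14.xp (k := k) (p := p))
  have hyp := RingQuot.mkAlgHom_rel k (RelC14.yp (k := k) (p := p))
  have hz := RingQuot.mkAlgHom_rel k (RelC14.zp (k := k) (p := p))
  simp only [map_sub, map_mul, map_pow, map_zero, sub_eq_zero] at hxy hxz hyz hx hyp hz
  set x := relGen (RelC14 k p) 0
  set y := relGen (RelC14 k p) 1
  set z := relGen (RelC14 k p) 2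
  have hzc (a : AlgC14 k p) : Commute a z :=
    (commute_of_commute_relGen (fun i => by
      fin_cases i
      exacts [hxz.symm, hyz.symm, rfl]) a).symm
  let c : ZMod p → AlgC14 k p := eigenIdem p k z
  have hc : CompleteOrthogonalIdempotents c := completeOrthogonalIdempotents_eigenIdem p hz
  have hcc (b : ZMod p) (a : AlgC14 k p) : Commute (c b) a :=
    (commute_eigenIdem p (hzc a) b).symm
  have hzcb (b : ZMod p) : z * c b = primeHom p k b • c b := mul_eigenIdem p hz b
  -- the nilpotent component
  let φ₀ : AlgC14 k p →ₐ[k] CyclicTruncated k (p - 1) p :=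
    relLift ![cyclicWeight p k _, arrowSum k _ _, 0] (by
      intro a b h
      cases h <;>
        simp only [map_sub, map_mul, map_pow, map_zero, FreeAlgebra.lift_ι_apply, Matrix.cons_val]
      · exact cyclicWeight_commutator p k p
      · rw [mul_zero, zero_mul, sub_zero]
      · rw [mul_zero, zero_mul, sub_zero]
      · exact cyclicWeight_pow_char p k _
      · exact arrowSum_pow k _ _
      · exact zero_pow hp)
  have hφ₀ (i) : φ₀ (relGen _ i) = _ := relLift_relGen _ _ i
  have hφ₀c (b : ZMod p) : φ₀ (c b) = if 0 = b then 1 else 0 := by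
    rw [map_eigenIdem, hφ₀, ← eigenIdem_algebraMap (k := k) p b 0, map_zero, map_zero]
    rfl
  -- In C14 the relation is y^p = z, so y is replaced by its component c 0 * y in the block z = 0,
  -- which satisfies the nilpotency that `cyclicLift` requires.
  have hy₀ : ∀ i, c 0 * y * primeIdem p k x i = primeIdem p k x (i + 1) * (c 0 * y) := fun i => by
    rw [mul_assoc, mul_primeIdem p hxy, ← mul_assoc, (hcc 0 _).eq, mul_assoc]
  have hyt₀ : (c 0 * y) ^ p = 0 := by
    rw [(hcc 0 y).mul_pow, hyp, ← pow_sub_one_mul hp, mul_assoc, (hzc _).eq, hzcb, map_zero,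
      zero_smul, mul_zero]
  let ψ₀ : CyclicTruncated k (p - 1) p →ₐ[k] AlgC14 k p :=
    cyclicLift (completeOrthogonalIdempotents_primeIdem p hx) hy₀ hyt₀
  have hψ₀X : ψ₀ (cyclicWeight p k p) = x := cyclicLift_cyclicWeight p hx _ _
  have hψ₀Y : ψ₀ (arrowSum k _ p) = c 0 * y := cyclicLift_arrowSum _ _ _
  have hφψ₀ : φ₀.comp ψ₀ = AlgHom.id k _ := by
    refine cyclicTruncated_algHom_ext (fun i => ?_) ?_
    · rw [AlgHom.comp_apply, cyclicLift_vertexIdem, map_primeIdem, hφ₀, Matrix.cons_val_zero,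
        primeIdem_cyclicWeight]; rfl
    · rw [AlgHom.comp_apply, hψ₀Y, map_mul, hφ₀c, if_pos rfl, one_mul, hφ₀]; rfl
  have hψφ₀ (a : AlgC14 k p) : c 0 * ψ₀ (φ₀ a) = c 0 * a := by
    refine central_mul_algHom_eq (hcc 0) (f := ψ₀.comp φ₀) (g := AlgHom.id k _) (fun i => ?_) a
    rw [AlgHom.comp_apply, hφ₀, AlgHom.id_apply]
    fin_cases i
    · exact congrArg _ hψ₀X
    · change _ * ψ₀ (arrowSum k _ p) = c 0 * y
      rw [hψ₀Y, ← mul_assoc, (hc.idem 0).eq]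
    · change _ * ψ₀ 0 = c 0 * z
      rw [map_zero, mul_zero, (hzc _).eq, hzcb, map_zero, zero_smul]
  -- the matrix components
  have hS := completeOrthogonalIdempotents_single p k
  have hPS (i : ZMod p) : shiftMatrix p k * Matrix.single i i 1 =
      Matrix.single (i + 1) (i + 1) 1 * shiftMatrix p k := by
    rw [shiftMatrix_mul_single, single_mul_shiftMatrix]
  -- As b^p = b, the matrix b • S with S^p = 1 is already a p-th root of the scalar b; hence no
  -- extension of k is needed.
  let φ (b : ZMod p) : AlgC14 k p →ₐ[k] Matrix (ZMod p) (ZMod p) k :=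
    relLift ![weightElem p hS k id, primeHom p k b • shiftMatrix p k,
      algebraMap k _ (primeHom p k b)] (by
      intro a b h
      cases h <;>
        simp only [map_sub, map_mul, map_pow, map_zero, FreeAlgebra.lift_ι_apply, Matrix.cons_val]
      · exact weightElem_commutator p hS (Equiv.addRight 1)
          (fun i => by
            rw [smul_mul_assoc, hPS, mul_smul_comm]; rfl) _ fun i => rfl
      · exact sub_eq_zero.2 (Algebra.commutes _ _).symm
      · exact sub_eq_zero.2 (Algebra.commutes _ _).symm
      · exact weightElem_pow_char _ _ _
      · rw [_root_.smul_pow, shiftMatrix_pow_card, primeHom_pow, Algebra.algebraMap_eq_smul_one]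
      · rw [← map_pow, primeHom_pow])
  have hφ (b i) : φ b (relGen _ i) = _ := relLift_relGen _ _ i
  have hφc (b b' : ZMod p) : φ b (c b') = if b = b' then 1 else 0 := by
    rw [map_eigenIdem, hφ]
    exact eigenIdem_algebraMap p b' b
  have hφe (b i : ZMod p) : φ b (eigenIdem p k x i) = Matrix.single i i 1 := by
    rw [map_eigenIdem, hφ]
    exact eigenIdem_weightElem_of_injective p hS Function.injective_id i
  let u (b : ZMod p) : AlgC14 k p := (primeHom p k b)⁻¹ • y
  have hφu {b : ZMod p} (hb : primeHom p k b ≠ 0) : φ b (u b) = shiftMatrix p k := by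
    rw [map_smul, hφ]
    exact inv_smul_smul₀ hb _
  have hyu {b : ZMod p} (hb : primeHom p k b ≠ 0) : y = primeHom p k b • u b :=
    (smul_inv_smul₀ hb y).symm
  have hcu {b : ZMod p} (hb : primeHom p k b ≠ 0) : c b * u b ^ p = c b := by
    rw [_root_.smul_pow, inv_pow, primeHom_pow, hyp, mul_smul_comm, (hcc b z).eq, hzcb,
      inv_smul_smul₀ hb]
  have hue (b i : ZMod p) : u b * eigenIdem p k x i = eigenIdem p k x (i + 1) * u b := by
    rw [smul_mul_assoc, mul_eigenIdem_of_commutator p hxy, mul_smul_comm]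
  let ψ (b : ZMod p) := matrixLift p k (c b) (u b) (eigenIdem p k x)
  have hφψ {b : ZMod p} (hb : primeHom p k b ≠ 0) (M) : φ b (ψ b M) = M :=
    map_matrixLift p (φ b) (by rw [hφc, if_pos rfl]) (hφu hb) (hφe b) M
  -- The map `ψ b` is only linear, and its multiplicativity is never needed: compatibility with left
  -- multiplication, evaluated at M = 1, gives ψ b (φ b a) = c b * a.
  have hψmul {b : ZMod p} (hb : primeHom p k b ≠ 0) (a : AlgC14 k p) :
      ∀ M, ψ b (φ b a * M) = a * ψ b M := by
    refine ringQuot_induction (P := fun a => ∀ M, ψ b (φ b a * M) = a * ψ b M) a (fun s M => ?_)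
      (fun i M => ?_) (fun a a' ha ha' M => ?_) fun a a' ha ha' M => ?_
    · rw [AlgHom.commutes, ← Algebra.smul_def, map_smul, Algebra.smul_def]
    · rw [hφ]
      fin_cases i
      · exact matrixLift_weightElem_mul p (fun i => mul_eigenIdem p hx i) (hcc b x) (hue b) M
      · change ψ b ((primeHom p k b • shiftMatrix p k) * M) = y * ψ b M
        rw [smul_mul_assoc, map_smul, hyu hb, smul_mul_assoc]
        exact congrArg _ (matrixLift_shiftMatrix_mul p (hcc b _) (hcu hb) M)
      · change ψ b (algebraMap k _ (primeHom p k b) * M) = z * ψ b M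
        rw [← Algebra.smul_def, map_smul]
        suffices h : (primeHom p k b) • ψ b = LinearMap.mulLeft k z ∘ₗ ψ b from
          LinearMap.congr_fun h M
        refine (Matrix.stdBasis k (ZMod p) (ZMod p)).ext fun s => ?_
        rw [Matrix.stdBasis_eq_single, LinearMap.smul_apply, LinearMap.comp_apply,
          LinearMap.mulLeft_apply, matrixLift_single, ← mul_assoc, ← mul_assoc, hzcb,
          smul_mul_assoc, smul_mul_assoc]
    · rw [map_add, add_mul, map_add, ha, ha', add_mul]
    · rw [map_mul (φ b), mul_assoc, ha, ha', mul_assoc]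
  have hψφ {b : ZMod p} (hb : primeHom p k b ≠ 0) (a : AlgC14 k p) : ψ b (φ b a) = c b * a := by
    have h := hψmul hb a 1
    rwa [mul_one, matrixLift_one p (completeOrthogonalIdempotents_eigenIdem p hx),
      ← (hcc b a).eq] at h
  -- the product
  let β : Fin (p - 1) ≃ {b : ZMod p // b ≠ 0} := Fintype.equivOfCardEq (by
    rw [Fintype.card_fin, Fintype.card_subtype_compl, ZMod.card, Fintype.card_subtype_eq])
  have hβ (i) : primeHom p k (β i : ZMod p) ≠ 0 := (_root_.map_ne_zero _).2 (β i).2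
  let ρ : Matrix (ZMod p) (ZMod p) k ≃ₐ[k] Matrix (Fin p) (Fin p) k :=
    Matrix.reindexAlgEquiv k k (ZMod.finEquiv p).symm.toEquiv
  refine ⟨AlgEquiv.ofBijective (φ₀.prod (AlgHom.pi fun i =>
    ρ.toAlgHom.comp (φ (β i)))) ⟨?_, fun m => ?_⟩⟩
  · rw [injective_iff_map_eq_zero]
    intro a ha
    rw [← one_mul a, ← hc.complete, Finset.sum_mul]
    refine Finset.sum_eq_zero fun b _ => ?_
    by_cases hb : b = 0
    · have h : φ₀ a = 0 := congrArg Prod.fst ha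
      rw [hb, ← hψφ₀, h, map_zero, mul_zero]
    · obtain ⟨i, hi⟩ := β.surjective ⟨b, hb⟩
      have h : ρ (φ (β i) a) = 0 := congrFun (congrArg Prod.snd ha) i
      rw [hi, EmbeddingLike.map_eq_zero_iff] at h
      rw [← hψφ ((_root_.map_ne_zero _).2 hb), h, map_zero]
  · have h₀ (m) : φ₀ (ψ₀ m) = m := DFunLike.congr_fun hφψ₀ m
    refine ⟨c 0 * ψ₀ m.1 + ∑ i, c (β i) * ψ (β i) (ρ.symm (m.2 i)), Prod.ext ?_ ?_⟩
    · change φ₀ _ = _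
      simp [hφ₀c, h₀, (β _).2.symm]
    · funext i
      change ρ (φ (β i) _) = _
      simp [hφc, hφψ (hβ i), (β _).2, Subtype.val_inj]

end C14

end SelfinjNaka

end

theorem mainTheorem3 (p : ℕ) [Fact p.Prime] (k : Type*) [Field k] [CharP k p] :
    (Nonempty (SelfinjNaka.AlgB2 k p ≃ₐ[k] SelfinjNaka.CyclicTruncated k (p ^ 2 - 1) p) ∧
      ¬ SelfinjNaka.IsSymmetricAlgebra k (SelfinjNaka.AlgB2 k p) ∧
      ¬ SelfinjNaka.IsSymmetricAlgebra k (SelfinjNaka.CyclicTruncated k (p ^ 2 - 1) p)) ∧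
    Nonempty (SelfinjNaka.AlgC12 k p ≃ₐ[k] SelfinjNaka.CyclicTruncated k (p - 1) (p ^ 2)) ∧
    (Nonempty (SelfinjNaka.AlgC13 k p ≃ₐ[k] (Fin p → SelfinjNaka.CyclicTruncated k (p - 1) p)) ∧
      Module.finrank k (SelfinjNaka.CyclicTruncated k (p - 1) p) = p ^ 2) ∧
    Nonempty (SelfinjNaka.AlgC14 k p ≃ₐ[k]
      (SelfinjNaka.CyclicTruncated k (p - 1) p × (Fin (p - 1) → Matrix (Fin p) (Fin p) k))) := by
  have hB2 := SelfinjNaka.nonempty_algB2_algEquiv p k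
  have hsymm := SelfinjNaka.not_isSymmetricAlgebra_cyclicTruncated_sq p k
  refine ⟨⟨hB2, fun h => ?_, hsymm⟩, SelfinjNaka.nonempty_algC12_algEquiv p k,
    ⟨SelfinjNaka.nonempty_algC13_algEquiv p k, ?_⟩, SelfinjNaka.nonempty_algC14_algEquiv p k⟩
  · obtain ⟨φ⟩ := hB2
    exact hsymm (SelfinjNaka.isSymmetricAlgebra_of_algEquiv φ h)
  · rw [SelfinjNaka.finrank_cyclicTruncated,
      Nat.sub_add_cancel (Fact.out : p.Prime).one_le, pow_two]
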